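/- Let $k$ be a perfect field of characteristic $p>0$, let $K/k$ be a field extension, and let $K^{\mathrm{perf}}$ be the perfect closure of $K$. Let $\mathcal D_\infty(K/k)$ be the category of triples $(V,W,\psi)$, where $V$ is a finite dimensional $K$-vector space, $W$ is a finite dimensional $k$-vector space and $\psi\colon K^{\mathrm{perf}}\otimes_K V\to K^{\mathrm{perf}}\otimes_k W$ is a $K^{\mathrm{perf}}$-linear isomorphism; an arrow $(V,W,\psi)\to(V',W',\psi')$ is a pair $(a,b)$ of a $K$-linear map $a\colon V\to V'$ and a $k$-linear map $b\colon W\to W'$ with $\psi'\circ(\mathrm{id}\otimes a)=(\mathrm{id}\otimes b)\circ\psi$. The tensor product is $(V,W,\psi)\otimes(V',W',\psi')=(V\otimes_KV',W\otimes_kW',\psi\otimes\psi')$, with unit object $(K,k,1)$, and $\mathrm{Pic}(\mathcal D_\infty(K/k))$ is the group of isomorphism classes of $\otimes$-invertible objects. Let $\omega\colon(V,W,\psi)\mapsto W$ be the forgetful fibre functor to finite dimensional $k$-vector spaces, and let $\pi^{\mathrm L}(K/k)=\underline{\mathrm{Aut}}^{\otimes}(\omega)$ be the associated Tannakian group, that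 is, the group functor sending a commutative $k$-algebra $R$ to the group of $R$-linear tensor automorphisms of $X\mapsto R\otimes_k\omega(X)$. Then $\pi^{\mathrm L}(K/k)$ is an affine group scheme over $k$, and there are canonical isomorphisms of groups \[ \mathrm{Pic}(\mathcal D_\infty(K/k))\;\simeq\;\mathrm{Hom}_k(\pi^{\mathrm L}(K/k),\mathbb G_m)\;\simeq\;(K^{\mathrm{perf}})^*/K^* . \] The first one sends the class of an invertible object $L$ to the character through which $\pi^{\mathrm L}(K/k)$ acts on the line $\omega(L)$. Under the composite, the class of $\varphi\in(K^{\mathrm{perf}})^*$ corresponds to the class of the rank-one object $(K,k,\varphi)$, where $\varphi$ acts by multiplication on $K^{\mathrm{perf}}\otimes_KK=K^{\mathrm{perf}}=K^{\mathrm{perf}}\otimes_kk$. -/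

import Mathlib

open CategoryTheory MonoidalCategory TensorProduct

universe u

noncomputable section

/-- Objects of the category `D_∞(K/k)`, where `P` stands for the perfect closure of `K`: triples
`(V, W, ψ)` of a finite dimensional `K`-vector space `V`, a finite dimensional `k`-vector space `W`
and a `P`-linear isomorphism `ψ : P ⊗_K V ≃ P ⊗_k W`. -/
structure DInf (k K P : Type u) [Field k] [Field K] [Field P] [Algebra K P] [Algebra k P] :
    Type (u + 1) where
  V : Type u
  W : Type u
  [addCommGroupV : AddCommGroup V]
  [moduleV : Module K V]
  [finiteV : Module.Finite K V]
  [addCommGroupW : AddCommGroup W]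
  [moduleW : Module k W]
  [finiteW : Module.Finite k W]
  ψ : P ⊗[K] V ≃ₗ[P] P ⊗[k] W

namespace DInf

attribute [instance] addCommGroupV moduleV finiteV addCommGroupW moduleW finiteW

variable {k K P : Type u} [Field k] [Field K] [Field P] [Algebra K P] [Algebra k P]

/-- Arrows of `D_∞(K/k)`: pairs of a `K`-linear map `a` and a `k`-linear map `b` that are compatible
with the isomorphisms `ψ`. -/
@[ext]
structure Hom (X Y : DInf k K P) : Type u where
  a : X.V →ₗ[K] Y.V
  b : X.W →ₗ[k] Y.W
  comm : Y.ψ.toLinearMap ∘ₗ a.baseChange P = b.baseChange P ∘ₗ X.ψ.toLinearMap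

theorem Hom.comm_apply {X Y : DInf k K P} (f : Hom X Y) (x : P ⊗[K] X.V) :
    Y.ψ (f.a.baseChange P x) = f.b.baseChange P (X.ψ x) :=
  LinearMap.congr_fun f.comm x

instance : Category (DInf k K P) where
  Hom := Hom
  id X := ⟨LinearMap.id, LinearMap.id, by ext; simp⟩
  comp f g := ⟨g.a ∘ₗ f.a, g.b ∘ₗ f.b, by
    rw [LinearMap.baseChange_comp, LinearMap.baseChange_comp, ← LinearMap.comp_assoc, g.comm,
      LinearMap.comp_assoc, f.comm, LinearMap.comp_assoc]⟩

@[ext]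
theorem hom_ext {X Y : DInf k K P} {f g : X ⟶ Y} (ha : f.a = g.a) (hb : f.b = g.b) : f = g :=
  Hom.ext ha hb

@[simp] theorem id_a (X : DInf k K P) : Hom.a (𝟙 X) = LinearMap.id := rfl
@[simp] theorem id_b (X : DInf k K P) : Hom.b (𝟙 X) = LinearMap.id := rfl
@[simp] theorem comp_a {X Y Z : DInf k K P} (f : X ⟶ Y) (g : Y ⟶ Z) :
    Hom.a (f ≫ g) = g.a ∘ₗ f.a := rfl
@[simp] theorem comp_b {X Y Z : DInf k K P} (f : X ⟶ Y) (g : Y ⟶ Z) :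
    Hom.b (f ≫ g) = g.b ∘ₗ f.b := rfl

/-- A pair of linear isomorphisms compatible with the `ψ` is an isomorphism of `D_∞(K/k)`. -/
def mkIso {X Y : DInf k K P} (a : X.V ≃ₗ[K] Y.V) (b : X.W ≃ₗ[k] Y.W)
    (h : Y.ψ.toLinearMap ∘ₗ a.toLinearMap.baseChange P =
      b.toLinearMap.baseChange P ∘ₗ X.ψ.toLinearMap) : X ≅ Y where
  hom := ⟨a.toLinearMap, b.toLinearMap, h⟩
  inv := ⟨a.symm.toLinearMap, b.symm.toLinearMap, by
    have ha : a.toLinearMap.baseChange P ∘ₗ a.symm.toLinearMap.baseChange P = LinearMap.id := by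
      rw [← LinearMap.baseChange_comp]; ext; simp
    have hb : b.symm.toLinearMap.baseChange P ∘ₗ b.toLinearMap.baseChange P = LinearMap.id := by
      rw [← LinearMap.baseChange_comp]; ext; simp
    calc X.ψ.toLinearMap ∘ₗ a.symm.toLinearMap.baseChange P
        = (b.symm.toLinearMap.baseChange P ∘ₗ b.toLinearMap.baseChange P) ∘ₗ
            X.ψ.toLinearMap ∘ₗ a.symm.toLinearMap.baseChange P := by rw [hb, LinearMap.id_comp]
      _ = b.symm.toLinearMap.baseChange P ∘ₗ (b.toLinearMap.baseChange P ∘ₗ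
            X.ψ.toLinearMap) ∘ₗ a.symm.toLinearMap.baseChange P := by
          simp only [LinearMap.comp_assoc]
      _ = b.symm.toLinearMap.baseChange P ∘ₗ Y.ψ.toLinearMap := by
          rw [← h, LinearMap.comp_assoc, ha, LinearMap.comp_id]⟩
  hom_inv_id := by ext <;> simp
  inv_hom_id := by ext <;> simp

/-- The isomorphism `P ⊗_K (V ⊗_K V') ≃ P ⊗_k (W ⊗_k W')` induced by `ψ` and `ψ'`. -/
def tensorψ (X Y : DInf k K P) : P ⊗[K] (X.V ⊗[K] Y.V) ≃ₗ[P] P ⊗[k] (X.W ⊗[k] Y.W) :=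
  AlgebraTensorModule.distribBaseChange K P X.V Y.V ≪≫ₗ
    TensorProduct.congr X.ψ Y.ψ ≪≫ₗ
    (AlgebraTensorModule.distribBaseChange k P X.W Y.W).symm

/-- `(V, W, ψ) ⊗ (V', W', ψ') = (V ⊗_K V', W ⊗_k W', ψ ⊗ ψ')`. -/
abbrev tensor (X Y : DInf k K P) : DInf k K P where
  V := X.V ⊗[K] Y.V
  W := X.W ⊗[k] Y.W
  ψ := tensorψ X Y

/-- The rank one object `(K, k, φ)`, where `φ ∈ P^*` acts by multiplication on
`P ⊗_K K = P = P ⊗_k k`. -/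
abbrev line (k K : Type u) {P : Type u} [Field k] [Field K] [Field P] [Algebra K P] [Algebra k P]
    (φ : Pˣ) : DInf k K P where
  V := K
  W := k
  ψ := AlgebraTensorModule.rid K P P ≪≫ₗ LinearEquiv.smulOfUnit φ ≪≫ₗ
    (AlgebraTensorModule.rid k P P).symm

theorem line_ψ_tmul (φ : Pˣ) (x : P) (y : K) :
    (line k K φ).ψ (x ⊗ₜ[K] (y : K)) = ((φ : P) * (y • x)) ⊗ₜ[k] (1 : k) :=
  rfl

theorem tensorψ_tmul (X Y : DInf k K P) (r : P) (v : X.V) (v' : Y.V) :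
    tensorψ X Y (r ⊗ₜ[K] (v ⊗ₜ[K] v')) =
      (AlgebraTensorModule.distribBaseChange k P X.W Y.W).symm
        (X.ψ (r ⊗ₜ[K] v) ⊗ₜ[P] Y.ψ (1 ⊗ₜ[K] v')) :=
  rfl

theorem map_baseChange_distrib {R M N M' N' : Type u} [Field R] [Algebra R P]
    [AddCommGroup M] [Module R M] [AddCommGroup N] [Module R N]
    [AddCommGroup M'] [Module R M'] [AddCommGroup N'] [Module R N']
    (f : M →ₗ[R] M') (g : N →ₗ[R] N') (s : P ⊗[R] M) (t : P ⊗[R] N) :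
    (TensorProduct.map f g).baseChange P
        ((AlgebraTensorModule.distribBaseChange R P M N).symm (s ⊗ₜ[P] t)) =
      (AlgebraTensorModule.distribBaseChange R P M' N').symm
        (f.baseChange P s ⊗ₜ[P] g.baseChange P t) := by
  induction s with
  | zero => simp
  | add s₁ s₂ h₁ h₂ => simp only [map_add, TensorProduct.add_tmul, h₁, h₂]
  | tmul p m =>
    induction t with
    | zero => simp
    | add t₁ t₂ h₁ h₂ => simp only [map_add, TensorProduct.tmul_add, h₁, h₂]
    | tmul q n => simp

theorem assoc_baseChange_distrib {R L M N : Type u} [Field R] [Algebra R P]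
    [AddCommGroup L] [Module R L] [AddCommGroup M] [Module R M] [AddCommGroup N] [Module R N]
    (r : P ⊗[R] L) (s : P ⊗[R] M) (t : P ⊗[R] N) :
    (TensorProduct.assoc R L M N).toLinearMap.baseChange P
        ((AlgebraTensorModule.distribBaseChange R P (L ⊗[R] M) N).symm
          ((AlgebraTensorModule.distribBaseChange R P L M).symm (r ⊗ₜ[P] s) ⊗ₜ[P] t)) =
      (AlgebraTensorModule.distribBaseChange R P L (M ⊗[R] N)).symm
        (r ⊗ₜ[P] (AlgebraTensorModule.distribBaseChange R P M N).symm (s ⊗ₜ[P] t)) := by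
  induction r with
  | zero => simp
  | add s₁ s₂ h₁ h₂ => simp only [map_add, TensorProduct.add_tmul, h₁, h₂]
  | tmul p m =>
    induction s with
    | zero => simp
    | add t₁ t₂ h₁ h₂ => simp only [map_add, TensorProduct.tmul_add, TensorProduct.add_tmul, h₁, h₂]
    | tmul q n =>
      induction t with
      | zero => simp
      | add t₁ t₂ h₁ h₂ => simp only [map_add, TensorProduct.tmul_add, h₁, h₂]
      | tmul q' n' => simp [mul_assoc]

theorem lid_baseChange_distrib {R M : Type u} [Field R] [Algebra R P]
    [AddCommGroup M] [Module R M] (p : P) (t : P ⊗[R] M) :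
    (TensorProduct.lid R M).toLinearMap.baseChange P
        ((AlgebraTensorModule.distribBaseChange R P R M).symm ((p ⊗ₜ[R] 1) ⊗ₜ[P] t)) = p • t := by
  induction t with
  | zero => simp
  | add t₁ t₂ h₁ h₂ => simp only [map_add, TensorProduct.tmul_add, h₁, h₂, smul_add]
  | tmul q n => simp [TensorProduct.smul_tmul']

theorem rid_baseChange_distrib {R M : Type u} [Field R] [Algebra R P]
    [AddCommGroup M] [Module R M] (p : P) (t : P ⊗[R] M) :
    (TensorProduct.rid R M).toLinearMap.baseChange P
        ((AlgebraTensorModule.distribBaseChange R P M R).symm (t ⊗ₜ[P] (p ⊗ₜ[R] 1))) = p • t := by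
  induction t with
  | zero => simp
  | add t₁ t₂ h₁ h₂ => simp only [map_add, TensorProduct.add_tmul, h₁, h₂, smul_add]
  | tmul q n => simp [TensorProduct.smul_tmul', mul_comm]

theorem baseChange_tensor_ext {R M N Q : Type u} [Field R] [Algebra R P]
    [AddCommGroup M] [Module R M] [AddCommGroup N] [Module R N] [AddCommGroup Q] [Module P Q]
    {f g : P ⊗[R] (M ⊗[R] N) →ₗ[P] Q}
    (h : ∀ m n, f (1 ⊗ₜ[R] (m ⊗ₜ[R] n)) = g (1 ⊗ₜ[R] (m ⊗ₜ[R] n))) : f = g := by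
  let _ := Module.compHom Q (algebraMap R P)
  have : IsScalarTower R P Q := ⟨fun r p q => by
    rw [Algebra.smul_def, mul_smul]; rfl⟩
  ext m n
  exact h m n

/-- The tensor product `(a ⊗ a', b ⊗ b')` of two arrows. -/
def homTensor {X X' Y Y' : DInf k K P} (f : X ⟶ X') (g : Y ⟶ Y') : tensor X Y ⟶ tensor X' Y' where
  a := TensorProduct.map f.a g.a
  b := TensorProduct.map f.b g.b
  comm := by
    refine baseChange_tensor_ext fun v v' => ?_
    change tensorψ X' Y' (1 ⊗ₜ[K] (f.a v ⊗ₜ[K] g.a v')) =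
      (TensorProduct.map f.b g.b).baseChange P (tensorψ X Y (1 ⊗ₜ[K] (v ⊗ₜ[K] v')))
    rw [tensorψ_tmul, tensorψ_tmul, map_baseChange_distrib, ← f.comm_apply, ← g.comm_apply,
      LinearMap.baseChange_tmul, LinearMap.baseChange_tmul]

def associatorIso (X Y Z : DInf k K P) : tensor (tensor X Y) Z ≅ tensor X (tensor Y Z) :=
  mkIso (TensorProduct.assoc K X.V Y.V Z.V) (TensorProduct.assoc k X.W Y.W Z.W) (by
    refine baseChange_tensor_ext fun xy z => ?_
    induction xy using TensorProduct.induction_on with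
    | zero => simp only [TensorProduct.zero_tmul, TensorProduct.tmul_zero, map_zero]
    | add s t hs ht => simp only [TensorProduct.add_tmul, TensorProduct.tmul_add, map_add, hs, ht]
    | tmul x y => ?_
    change tensorψ X (tensor Y Z) (1 ⊗ₜ[K] (x ⊗ₜ[K] (y ⊗ₜ[K] z))) =
      (TensorProduct.assoc k X.W Y.W Z.W).toLinearMap.baseChange P
        (tensorψ (tensor X Y) Z (1 ⊗ₜ[K] ((x ⊗ₜ[K] y) ⊗ₜ[K] z)))
    rw [tensorψ_tmul, tensorψ_tmul]
    exact (assoc_baseChange_distrib (X.ψ (1 ⊗ₜ x)) (Y.ψ (1 ⊗ₜ y)) (Z.ψ (1 ⊗ₜ z))).symm)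

theorem ψ_smul (X : DInf k K P) (c : K) (x : X.V) :
    X.ψ (1 ⊗ₜ[K] (c • x)) = (c • (1 : P)) • X.ψ (1 ⊗ₜ[K] x) := by
  rw [← map_smul, TensorProduct.smul_tmul', smul_eq_mul, mul_one, TensorProduct.smul_tmul]

def leftUnitorIso (X : DInf k K P) : tensor (line k K 1) X ≅ X :=
  mkIso (TensorProduct.lid K X.V) (TensorProduct.lid k X.W) (by
    refine baseChange_tensor_ext fun (c : K) x => ?_
    have h : (line k K (1 : Pˣ)).ψ (1 ⊗ₜ[K] c) = (c • (1 : P)) ⊗ₜ[k] (1 : k) := by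
      rw [line_ψ_tmul, Units.val_one, one_mul]
    change X.ψ (1 ⊗ₜ[K] (c • x)) =
      (TensorProduct.lid k X.W).toLinearMap.baseChange P
        (tensorψ (line k K 1) X (1 ⊗ₜ[K] (c ⊗ₜ[K] x)))
    rw [tensorψ_tmul, h, ψ_smul]
    exact (lid_baseChange_distrib _ (X.ψ (1 ⊗ₜ x))).symm)

def rightUnitorIso (X : DInf k K P) : tensor X (line k K 1) ≅ X :=
  mkIso (TensorProduct.rid K X.V) (TensorProduct.rid k X.W) (by
    refine baseChange_tensor_ext fun x (c : K) => ?_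
    have h : (line k K (1 : Pˣ)).ψ (1 ⊗ₜ[K] c) = (c • (1 : P)) ⊗ₜ[k] (1 : k) := by
      rw [line_ψ_tmul, Units.val_one, one_mul]
    change X.ψ (1 ⊗ₜ[K] (c • x)) =
      (TensorProduct.rid k X.W).toLinearMap.baseChange P
        (tensorψ X (line k K 1) (1 ⊗ₜ[K] (x ⊗ₜ[K] c)))
    rw [tensorψ_tmul, h, ψ_smul]
    exact (rid_baseChange_distrib _ (X.ψ (1 ⊗ₜ x))).symm)

instance : MonoidalCategoryStruct (DInf k K P) where
  tensorObj := tensor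
  tensorUnit := line k K 1
  tensorHom f g := homTensor f g
  whiskerLeft X _ _ f := homTensor (𝟙 X) f
  whiskerRight f Y := homTensor f (𝟙 Y)
  associator := associatorIso
  leftUnitor := leftUnitorIso
  rightUnitor := rightUnitorIso

instance : MonoidalCategory (DInf k K P) where
  tensorHom_def f g := by
    apply hom_ext <;> apply TensorProduct.ext' <;> intros <;> rfl
  id_tensorHom_id X Y := by
    apply hom_ext <;> apply TensorProduct.ext' <;> intros <;> rfl
  tensorHom_comp_tensorHom f₁ f₂ g₁ g₂ := by
    apply hom_ext <;> apply TensorProduct.ext' <;> intros <;> rfl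
  whiskerLeft_id X Y := by
    apply hom_ext <;> apply TensorProduct.ext' <;> intros <;> rfl
  id_whiskerRight X Y := by
    apply hom_ext <;> apply TensorProduct.ext' <;> intros <;> rfl
  associator_naturality f₁ f₂ f₃ := by
    apply hom_ext <;> apply TensorProduct.ext_threefold <;> intros <;> rfl
  leftUnitor_naturality f := by
    apply hom_ext
    · exact TensorProduct.ext' fun (c : K) x => ((Hom.a f).map_smul c x).symm
    · exact TensorProduct.ext' fun (c : k) x => ((Hom.b f).map_smul c x).symm
  rightUnitor_naturality f := by
    apply hom_ext
    · exact TensorProduct.ext' fun x (c : K) => ((Hom.a f).map_smul c x).symm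
    · exact TensorProduct.ext' fun x (c : k) => ((Hom.b f).map_smul c x).symm
  pentagon W X Y Z := by
    apply hom_ext <;> apply TensorProduct.ext_fourfold <;> intros <;> rfl
  triangle X Y := by
    apply hom_ext
    · exact TensorProduct.ext_threefold fun x (c : K) y => (TensorProduct.smul_tmul c x y).symm
    · exact TensorProduct.ext_threefold fun x (c : k) y => (TensorProduct.smul_tmul c x y).symm

/-- The Picard group of `D_∞(K/k)`: isomorphism classes of objects that are invertible for the
tensor product. -/
abbrev Pic (k K P : Type u) [Field k] [Field K] [Field P] [Algebra K P] [Algebra k P] :=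
  (Skeleton (DInf k K P))ˣ

end DInf

/-- The base change `S ⊗_R g` along `f : R → S` of an `R`-linear endomorphism `g` of `R ⊗_k W`,
as an endomorphism of `S ⊗_k W`. -/
def endBaseChange {k R S W : Type u} [Field k] [CommRing R] [Algebra k R] [CommRing S] [Algebra k S]
    [AddCommGroup W] [Module k W] (f : R →ₐ[k] S) (g : R ⊗[k] W →ₗ[R] R ⊗[k] W) :
    S ⊗[k] W →ₗ[S] S ⊗[k] W :=
  LinearMap.liftBaseChange S
    (LinearMap.rTensor W f.toLinearMap ∘ₗ g.restrictScalars k ∘ₗ TensorProduct.mk k R W 1)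

section endBaseChange

variable {k R S W W' : Type u} [Field k] [CommRing R] [Algebra k R] [CommRing S] [Algebra k S]
  [AddCommGroup W] [Module k W] [AddCommGroup W'] [Module k W'] (f : R →ₐ[k] S)

theorem rTensor_algHom_smul (r : R) (x : R ⊗[k] W) :
    LinearMap.rTensor W f.toLinearMap (r • x) = f r • LinearMap.rTensor W f.toLinearMap x := by
  induction x with
  | zero => simp
  | add x y hx hy => simp only [smul_add, map_add, hx, hy]
  | tmul a w => simp [TensorProduct.smul_tmul']

theorem endBaseChange_rTensor (g : R ⊗[k] W →ₗ[R] R ⊗[k] W) (x : R ⊗[k] W) :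
    endBaseChange f g (LinearMap.rTensor W f.toLinearMap x) =
      LinearMap.rTensor W f.toLinearMap (g x) := by
  induction x with
  | zero => simp
  | add x y hx hy => simp only [map_add, hx, hy]
  | tmul a w =>
    have h : a ⊗ₜ[k] w = a • ((1 : R) ⊗ₜ[k] w) := by simp [TensorProduct.smul_tmul']
    rw [h, rTensor_algHom_smul, map_smul, map_smul, rTensor_algHom_smul]
    simp [endBaseChange]

/-- An `S`-linear map out of `S ⊗_k W` is determined on the image of `R ⊗_k W`. -/
theorem ext_rTensor {Q : Type u} [AddCommGroup Q] [Module S Q] {a b : S ⊗[k] W →ₗ[S] Q}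
    (h : ∀ x : R ⊗[k] W, a (LinearMap.rTensor W f.toLinearMap x) =
      b (LinearMap.rTensor W f.toLinearMap x)) : a = b := by
  refine LinearMap.ext fun y => ?_
  induction y with
  | zero => simp
  | add x y hx hy => simp only [map_add, hx, hy]
  | tmul s w =>
    have hw : s ⊗ₜ[k] w = s • LinearMap.rTensor W f.toLinearMap ((1 : R) ⊗ₜ[k] w) := by
      simp [TensorProduct.smul_tmul']
    rw [hw, map_smul, map_smul, h]

theorem endBaseChange_one : endBaseChange f (LinearMap.id : R ⊗[k] W →ₗ[R] _) = LinearMap.id :=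
  ext_rTensor f fun x => by rw [endBaseChange_rTensor]; rfl

theorem endBaseChange_comp (g h : R ⊗[k] W →ₗ[R] R ⊗[k] W) :
    endBaseChange f (g ∘ₗ h) = endBaseChange f g ∘ₗ endBaseChange f h :=
  ext_rTensor f fun x => by
    rw [endBaseChange_rTensor, LinearMap.comp_apply, LinearMap.comp_apply, endBaseChange_rTensor,
      endBaseChange_rTensor]

/-- Base change along `f : R → S` as a map `GL_R(R ⊗_k W) → GL_S(S ⊗_k W)`. -/
def autBaseChange (g : R ⊗[k] W ≃ₗ[R] R ⊗[k] W) : S ⊗[k] W ≃ₗ[S] S ⊗[k] W :=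
  LinearEquiv.ofLinearMap (endBaseChange f g.toLinearMap) (endBaseChange f g.symm.toLinearMap)
    (by rw [← endBaseChange_comp, LinearEquiv.comp_symm, endBaseChange_one])
    (by rw [← endBaseChange_comp, LinearEquiv.symm_comp, endBaseChange_one])

theorem autBaseChange_rTensor (g : R ⊗[k] W ≃ₗ[R] R ⊗[k] W) (x : R ⊗[k] W) :
    autBaseChange f g (LinearMap.rTensor W f.toLinearMap x) =
      LinearMap.rTensor W f.toLinearMap (g x) :=
  endBaseChange_rTensor f g.toLinearMap x

theorem baseChange_rTensor (b : W →ₗ[k] W') (x : R ⊗[k] W) :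
    b.baseChange S (LinearMap.rTensor W f.toLinearMap x) =
      LinearMap.rTensor W' f.toLinearMap (b.baseChange R x) := by
  induction x with
  | zero => simp
  | add x y hx hy => simp only [map_add, hx, hy]
  | tmul a w => simp

theorem distrib_symm_rTensor (s : R ⊗[k] W) (t : R ⊗[k] W') :
    (AlgebraTensorModule.distribBaseChange k S W W').symm
        (LinearMap.rTensor W f.toLinearMap s ⊗ₜ[S] LinearMap.rTensor W' f.toLinearMap t) =
      LinearMap.rTensor (W ⊗[k] W') f.toLinearMap
        ((AlgebraTensorModule.distribBaseChange k R W W').symm (s ⊗ₜ[R] t)) := by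
  induction s with
  | zero => simp
  | add x y hx hy => simp only [map_add, TensorProduct.add_tmul, hx, hy]
  | tmul a w =>
    induction t with
    | zero => simp
    | add x y hx hy => simp only [map_add, TensorProduct.tmul_add, hx, hy]
    | tmul a' w' => simp

end endBaseChange

/-- The group `π^L(K/k)(R) = Aut^⊗(ω)(R)` of `R`-points of the Tannakian group scheme attached to
the fibre functor `ω : D_∞(K/k) → Vect(k)`, `(V, W, ψ) ↦ W`: families `g` of `R`-linear automorphisms
`g_X` of `R ⊗_k ω(X)` that are natural in `X` and compatible with tensor products and the unit
object. -/
def localNori (k K P : Type u) [Field k] [Field K] [Field P] [Algebra K P] [Algebra k P]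
    (R : Type u) [CommRing R] [Algebra k R] :
    Subgroup (∀ X : DInf k K P, R ⊗[k] X.W ≃ₗ[R] R ⊗[k] X.W) where
  carrier := {g |
    (∀ (X Y : DInf k K P) (f : X ⟶ Y) (x : R ⊗[k] X.W),
      g Y (f.b.baseChange R x) = f.b.baseChange R (g X x)) ∧
    (∀ (X Y : DInf k K P) (x : R ⊗[k] X.W) (y : R ⊗[k] Y.W),
      g (X ⊗ Y) ((AlgebraTensorModule.distribBaseChange k R X.W Y.W).symm (x ⊗ₜ[R] y)) =
        (AlgebraTensorModule.distribBaseChange k R X.W Y.W).symm (g X x ⊗ₜ[R] g Y y)) ∧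
    (∀ x, g (𝟙_ (DInf k K P)) x = x)}
  one_mem' := ⟨fun _ _ _ _ => rfl, fun _ _ _ _ => rfl, fun _ => rfl⟩
  mul_mem' {g h} hg hh := by
    refine ⟨fun X Y f x => ?_, fun X Y x y => ?_, fun x => ?_⟩
    · change g Y (h Y _) = _
      rw [hh.1, hg.1]; rfl
    · change g (X ⊗ Y) (h (X ⊗ Y) _) = _
      rw [hh.2.1, hg.2.1]; rfl
    · change g _ (h _ x) = x
      rw [hh.2.2, hg.2.2]
  inv_mem' {g} hg := by
    refine ⟨fun X Y f x => ?_, fun X Y x y => ?_, fun x => ?_⟩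
    · change (g Y).symm _ = _
      rw [LinearEquiv.symm_apply_eq, hg.1]
      exact congrArg _ ((g X).apply_symm_apply x).symm
    · change (g (X ⊗ Y)).symm _ = _
      rw [LinearEquiv.symm_apply_eq, hg.2.1]
      exact congrArg _ (congrArg₂ _ ((g X).apply_symm_apply x).symm
        ((g Y).apply_symm_apply y).symm)
    · change (g _).symm x = x
      rw [LinearEquiv.symm_apply_eq, hg.2.2]

namespace localNori

variable {k K P : Type u} [Field k] [Field K] [Field P] [Algebra K P] [Algebra k P]
  {R S : Type u} [CommRing R] [Algebra k R] [CommRing S] [Algebra k S]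

/-- Functoriality of `R ↦ π^L(K/k)(R)`: base change of automorphisms along `f : R → S`. -/
def map (f : R →ₐ[k] S) : localNori k K P R →* localNori k K P S where
  toFun g := ⟨fun X => autBaseChange f (g.1 X), by
    refine ⟨fun X Y φ x => ?_, fun X Y x y => ?_, fun x => ?_⟩
    · refine LinearMap.congr_fun (f := (autBaseChange f (g.1 Y)).toLinearMap ∘ₗ φ.b.baseChange S)
        (g := φ.b.baseChange S ∘ₗ (autBaseChange f (g.1 X)).toLinearMap)
        (ext_rTensor f fun x => ?_) x
      simp only [LinearMap.comp_apply, LinearEquiv.coe_coe, baseChange_rTensor,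
        autBaseChange_rTensor, g.2.1]
    · let d := AlgebraTensorModule.distribBaseChange k S X.W Y.W
      let A : S ⊗[k] X.W →ₗ[S] S ⊗[k] Y.W →ₗ[S] S ⊗[k] (X.W ⊗[k] Y.W) :=
        (TensorProduct.mk S (S ⊗[k] X.W) (S ⊗[k] Y.W)).compr₂
          ((autBaseChange f (g.1 (X ⊗ Y))).toLinearMap ∘ₗ d.symm.toLinearMap)
      let B : S ⊗[k] X.W →ₗ[S] S ⊗[k] Y.W →ₗ[S] S ⊗[k] (X.W ⊗[k] Y.W) :=
        ((TensorProduct.mk S (S ⊗[k] X.W) (S ⊗[k] Y.W)).compl₁₂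
          (autBaseChange f (g.1 X)).toLinearMap (autBaseChange f (g.1 Y)).toLinearMap).compr₂
            d.symm.toLinearMap
      have hAB : A = B := ext_rTensor f fun s => ext_rTensor f fun t => by
        change autBaseChange f (g.1 (X ⊗ Y))
            (d.symm (LinearMap.rTensor _ f.toLinearMap s ⊗ₜ[S] LinearMap.rTensor _ f.toLinearMap t)) =
          d.symm (autBaseChange f (g.1 X) (LinearMap.rTensor _ f.toLinearMap s) ⊗ₜ[S]
            autBaseChange f (g.1 Y) (LinearMap.rTensor _ f.toLinearMap t))
        rw [autBaseChange_rTensor, autBaseChange_rTensor, distrib_symm_rTensor,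
          distrib_symm_rTensor, ← g.2.2.1]
        exact autBaseChange_rTensor f _ _
      exact LinearMap.congr_fun₂ hAB x y
    · refine LinearMap.congr_fun (f := (autBaseChange f (g.1 (𝟙_ (DInf k K P)))).toLinearMap)
        (g := LinearMap.id) (ext_rTensor f fun x => ?_) x
      rw [LinearEquiv.coe_coe, autBaseChange_rTensor, g.2.2.2]; rfl⟩
  map_one' := Subtype.ext <| funext fun X => LinearEquiv.toLinearMap_injective <|
    endBaseChange_one f
  map_mul' g h := Subtype.ext <| funext fun X => LinearEquiv.toLinearMap_injective <|
    endBaseChange_comp f (g.1 X).toLinearMap (h.1 X).toLinearMap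

/-- The group functor `π^L(K/k)` is an affine scheme: it is represented by a commutative
`k`-algebra `A`, with universal point `g ∈ π^L(K/k)(A)`. -/
def IsAffineGroupScheme (k K P : Type u) [Field k] [Field K] [Field P] [Algebra K P] [Algebra k P] :
    Prop :=
  ∃ (A : CommAlgCat.{u} k) (g : localNori k K P A),
    ∀ (R : CommAlgCat.{u} k) (h : localNori k K P R), ∃! f : A →ₐ[k] R, map f g = h

/-- The group `Hom_k(π^L(K/k), 𝔾_m)`: homomorphisms of group functors on commutative `k`-algebras,
with pointwise multiplication. -/
def characters (k K P : Type u) [Field k] [Field K] [Field P] [Algebra K P] [Algebra k P] :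
    Subgroup (∀ R : CommAlgCat.{u} k, localNori k K P R →* Rˣ) where
  carrier := {χ | ∀ (R S : CommAlgCat.{u} k) (f : R →ₐ[k] S) (g : localNori k K P R),
    ((χ S (map f g) : Sˣ) : S) = f (χ R g : Rˣ)}
  one_mem' R S f g := by simp
  mul_mem' {χ χ'} h h' R S f g := by simp [h R S f g, h' R S f g]
  inv_mem' {χ} h R S f g := by
    have h1 : χ S (map f g) = Units.map (f : R →* S) (χ R g) := Units.ext (h R S f g)
    change (((χ S (map f g))⁻¹ : Sˣ) : S) = f (((χ R g)⁻¹ : Rˣ) : R)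
    rw [h1, ← map_inv]; rfl

end localNori

end

/-! Write `P` for the perfect closure. Invertible objects have rank one on both sides, so after a
choice of bases each is a line `(K, k, φ)` with `φ ∈ P^*`. The tensor product multiplies the `φ`, so
`P^*` surjects onto `Pic` and, through the action on lines, maps to the characters. The theorem
reduces to two facts: both homomorphisms have kernel `K^*`, and every character comes from a line.

Affineness: the coordinate ring consists of the polynomials in the matrix entries of points, modulo
those that vanish at every point over every algebra. Direct sums, tensor products and the unit show
that every such polynomial is again a matrix coefficient `⟨ξ, g w⟩`. Duals show that the
coefficients of `g⁻¹` are of this kind too. Hence the universal matrices glue to a universal point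
(`exists_universal_point`), and by evaluation there every character is a matrix coefficient
(`isCoeff_character`).

The link with `P/K` is the canonical point over `P ⊗_K P`, which compares the two base changes of
`ψ`. It acts on `(K, k, φ)` by `(φ ⊗ 1)(1 ⊗ φ)⁻¹`, and this is `1` only if `φ ∈ K`. Its action is
also a descent datum: a subspace of `W` stable under it underlies a subobject (`exists_subobject`).

Given a character `χ = ⟨ξ, g w⟩` on `X`, the vectors `v` with `⟨ξ, g v⟩ = ξ(v) χ(g)` for all `g`
form a stable subspace, hence a subobject `Y`. On `Y` the form `ξ` is nonzero and transforms through
`χ`. The functional `v ↦ ξ(ψ(1 ⊗ v))` then takes values in a single line `K φ` of `P`, so `ξ`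
underlies an arrow from `Y` to `(K, k, φ)`, whose character must be `χ` (`exists_hom_line`,
`lineCharacter_surjective`). -/

noncomputable section

/-! ### Direct sums, duals and standard objects of `D_∞(K/k)` -/

namespace DInf

variable {k K P : Type u} [Field k] [Field K] [Field P] [Algebra K P] [Algebra k P]

/-- The direct sum `(V × V', W × W', ψ × ψ')`. -/
abbrev prod (X Y : DInf k K P) : DInf k K P where
  V := X.V × Y.V
  W := X.W × Y.W
  ψ := TensorProduct.prodRight K P P X.V Y.V ≪≫ₗ
    LinearEquiv.prodCongr X.ψ Y.ψ ≪≫ₗ (TensorProduct.prodRight k P P X.W Y.W).symm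

theorem prodRight_symm_inl {R M N : Type u} [Field R] [Algebra R P]
    [AddCommGroup M] [Module R M] [AddCommGroup N] [Module R N] (x : P ⊗[R] M) :
    (TensorProduct.prodRight R P P M N).symm (x, 0) =
      (LinearMap.inl R M N).baseChange P x := by
  rw [LinearEquiv.symm_apply_eq]
  induction x with
  | zero => simp
  | add x y hx hy => rw [map_add, map_add, ← hx, ← hy]; simp
  | tmul a m => simp

theorem prodRight_symm_inr {R M N : Type u} [Field R] [Algebra R P]
    [AddCommGroup M] [Module R M] [AddCommGroup N] [Module R N] (x : P ⊗[R] N) :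
    (TensorProduct.prodRight R P P M N).symm (0, x) =
      (LinearMap.inr R M N).baseChange P x := by
  rw [LinearEquiv.symm_apply_eq]
  induction x with
  | zero => simp
  | add x y hx hy => rw [map_add, map_add, ← hx, ← hy]; simp
  | tmul a m => simp

/-- The inclusion of the first summand. -/
def inl (X Y : DInf k K P) : X ⟶ prod X Y where
  a := LinearMap.inl K X.V Y.V
  b := LinearMap.inl k X.W Y.W
  comm := by
    ext v
    have h := prodRight_symm_inl (N := Y.W) (X.ψ (1 ⊗ₜ[K] v))
    simpa using h

/-- The inclusion of the second summand. -/
def inr (X Y : DInf k K P) : Y ⟶ prod X Y where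
  a := LinearMap.inr K X.V Y.V
  b := LinearMap.inr k X.W Y.W
  comm := by
    ext v
    have h := prodRight_symm_inr (M := X.W) (Y.ψ (1 ⊗ₜ[K] v))
    simpa using h

/-- The canonical isomorphism `P ⊗ M^* ≃ (P ⊗ M)^*`. -/
def dualBaseChange (R M : Type u) [Field R] [Algebra R P] [AddCommGroup M] [Module R M]
    [Module.Finite R M] : P ⊗[R] Module.Dual R M ≃ₗ[P] Module.Dual P (P ⊗[R] M) :=
  (TensorProduct.isBaseChange R M P).toDualBaseChange

theorem dualBaseChange_tmul {R M : Type u} [Field R] [Algebra R P] [AddCommGroup M] [Module R M]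
    [Module.Finite R M] (a : P) (f : Module.Dual R M) (x : P ⊗[R] M) :
    dualBaseChange R M (a ⊗ₜ f) x = a * Module.Dual.baseChange P f x := by
  induction x with
  | zero => simp
  | add x y hx hy => simp only [map_add, mul_add, hx, hy]
  | tmul b m =>
    have h := (TensorProduct.isBaseChange R M P).toDualBaseChange_tmul a f m
    have hb : b ⊗ₜ[R] m = b • TensorProduct.mk R P M 1 m := by simp [TensorProduct.smul_tmul']
    rw [hb, map_smul, map_smul]
    change b • _ = _
    rw [dualBaseChange, h]
    simp [Algebra.smul_def, mul_left_comm]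

/-- The scalar ring is an arbitrary algebra `S` because the formula serves both `P`, in the
construction of the evaluation arrow, and the test algebras over which points are taken. -/
theorem contractLeft_baseChange_distrib {R M : Type u} {S : Type u} [CommRing S] [Field R]
    [Algebra R S] [AddCommGroup M] [Module R M] (f : Module.Dual R M) (a : S) (x : S ⊗[R] M) :
    (contractLeft R M).baseChange S
      ((AlgebraTensorModule.distribBaseChange R S (Module.Dual R M) M).symm
        ((a ⊗ₜ f) ⊗ₜ[S] x)) = (a * Module.Dual.baseChange S f x) ⊗ₜ 1 := by
  induction x with
  | zero => simp
  | add x y hx hy => simp only [map_add, mul_add, TensorProduct.tmul_add, hx, hy,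
      TensorProduct.add_tmul]
  | tmul b m =>
    simp only [AlgebraTensorModule.distribBaseChange_symm_tmul, LinearMap.baseChange_tmul,
      contractLeft_apply, Module.Dual.baseChange_apply_tmul]
    rw [mul_smul_comm, TensorProduct.smul_tmul, smul_eq_mul, mul_one]

/-- The dual object `(V^*, W^*, (ψ^*)⁻¹)`. -/
abbrev dual (X : DInf k K P) : DInf k K P where
  V := Module.Dual K X.V
  W := Module.Dual k X.W
  ψ := dualBaseChange K X.V ≪≫ₗ X.ψ.symm.dualMap ≪≫ₗ (dualBaseChange k X.W).symm

theorem contractLeft_baseChange_distrib_eq {R M : Type u} [Field R] [Algebra R P] [AddCommGroup M]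
    [Module R M] [Module.Finite R M] (f : P ⊗[R] Module.Dual R M) (x : P ⊗[R] M) :
    (contractLeft R M).baseChange P
      ((AlgebraTensorModule.distribBaseChange R P (Module.Dual R M) M).symm (f ⊗ₜ[P] x)) =
        dualBaseChange R M f x ⊗ₜ 1 := by
  induction f with
  | zero => simp
  | add x y hx hy => simp only [map_add, TensorProduct.add_tmul, hx, hy, LinearMap.add_apply]
  | tmul b m => rw [contractLeft_baseChange_distrib, dualBaseChange_tmul]

/-- The evaluation `X^* ⊗ X ⟶ 𝟙`. -/
def evaluation (X : DInf k K P) : tensor (dual X) X ⟶ line k K 1 where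
  a := contractLeft K X.V
  b := contractLeft k X.W
  comm := by
    refine baseChange_tensor_ext fun f v => ?_
    change (line k K (1 : Pˣ)).ψ (1 ⊗ₜ (f v)) = (contractLeft k X.W).baseChange P
      (tensorψ (dual X) X (1 ⊗ₜ[K] (f ⊗ₜ[K] v)))
    rw [tensorψ_tmul, contractLeft_baseChange_distrib_eq, line_ψ_tmul]
    congr 1
    -- The structure map of the dual is the inverse transpose of `ψ`, so it cancels against `ψ` in
    -- the pairing.
    change _ = dualBaseChange k X.W ((dualBaseChange k X.W).symm (X.ψ.symm.dualMap
      (dualBaseChange K X.V (1 ⊗ₜ f)))) _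
    rw [LinearEquiv.apply_symm_apply, LinearEquiv.dualMap_apply, LinearEquiv.symm_apply_apply,
      dualBaseChange_tmul]
    simp

/-- Transport of the structure of an object along linear isomorphisms. -/
abbrev ofEquiv (X : DInf k K P) {V W : Type u} [AddCommGroup V] [Module K V] [Module.Finite K V]
    [AddCommGroup W] [Module k W] [Module.Finite k W] (a : X.V ≃ₗ[K] V) (b : X.W ≃ₗ[k] W) :
    DInf k K P where
  V := V
  W := W
  ψ := (a.baseChange K P X.V V).symm ≪≫ₗ X.ψ ≪≫ₗ b.baseChange k P X.W W

def isoOfEquiv (X : DInf k K P) {V W : Type u} [AddCommGroup V] [Module K V] [Module.Finite K V]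
    [AddCommGroup W] [Module k W] [Module.Finite k W] (a : X.V ≃ₗ[K] V) (b : X.W ≃ₗ[k] W) :
    X ≅ X.ofEquiv a b :=
  mkIso a b (by
    ext v
    change b.baseChange k P X.W W (X.ψ ((a.baseChange K P X.V V).symm (1 ⊗ₜ a v))) =
      b.toLinearMap.baseChange P (X.ψ (1 ⊗ₜ v))
    have h : (a.baseChange K P X.V V).symm (1 ⊗ₜ a v) = 1 ⊗ₜ v := by
      rw [LinearEquiv.symm_apply_eq]; rfl
    rw [h]; rfl)

/-- A small family of objects, in which every isomorphism class is represented. -/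
structure Std (k K P : Type u) [Field k] [Field K] [Field P] [Algebra K P] [Algebra k P] :
    Type u where
  m : ℕ
  n : ℕ
  ψ : P ⊗[K] (Fin m → K) ≃ₗ[P] P ⊗[k] (Fin n → k)

abbrev Std.obj (s : Std k K P) : DInf k K P where
  V := Fin s.m → K
  W := Fin s.n → k
  ψ := s.ψ

/-- Bases of `V` and `W` turn `ψ` into a standard object. Standard objects form a type in universe
`u`, while all objects live in `u + 1`; this keeps the coordinate ring in universe `u`. -/
theorem exists_std (X : DInf k K P) : ∃ s : Std k K P, Nonempty (X ≅ s.obj) :=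
  ⟨⟨_, _, (X.ofEquiv (Module.finBasis K X.V).equivFun (Module.finBasis k X.W).equivFun).ψ⟩,
    ⟨X.isoOfEquiv _ _⟩⟩

end DInf

/-! ### Coordinates on `R ⊗ W` and gluing of endomorphisms -/

section coordinates

variable {k R S W W' : Type u} [Field k] [CommRing R] [Algebra k R] [CommRing S] [Algebra k S]
  [AddCommGroup W] [Module k W] [AddCommGroup W'] [Module k W']

theorem dual_baseChange_rTensor (f : R →ₐ[k] S) (ξ : Module.Dual k W) (x : R ⊗[k] W) :
    Module.Dual.baseChange S ξ (LinearMap.rTensor W f.toLinearMap x) =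
      f (Module.Dual.baseChange R ξ x) := by
  induction x with
  | zero => simp
  | add x y hx hy => simp only [map_add, hx, hy]
  | tmul a w => simp

theorem dual_baseChange_comp (b : W →ₗ[k] W') (ξ : Module.Dual k W') (x : R ⊗[k] W) :
    Module.Dual.baseChange R ξ (b.baseChange R x) = Module.Dual.baseChange R (ξ ∘ₗ b) x := by
  induction x with
  | zero => simp
  | add x y hx hy => simp only [map_add, hx, hy]
  | tmul a w => simp

theorem dual_baseChange_distrib (ξ : Module.Dual k W) (ξ' : Module.Dual k W')
    (x : R ⊗[k] W) (y : R ⊗[k] W') :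
    Module.Dual.baseChange R (LinearMap.mul' k k ∘ₗ TensorProduct.map ξ ξ')
      ((AlgebraTensorModule.distribBaseChange k R W W').symm (x ⊗ₜ[R] y)) =
      Module.Dual.baseChange R ξ x * Module.Dual.baseChange R ξ' y := by
  induction x with
  | zero => simp
  | add x y hx hy => simp only [map_add, TensorProduct.add_tmul, add_mul, hx, hy]
  | tmul a w =>
    induction y with
    | zero => simp
    | add x y hx hy => simp only [map_add, TensorProduct.tmul_add, mul_add, hx, hy]
    | tmul a' w' => simp [mul_comm (ξ w), mul_smul]

theorem sum_coord_tmul {ι : Type*} [Fintype ι] (b : Module.Basis ι k W) (x : R ⊗[k] W) :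
    ∑ i, Module.Dual.baseChange R (b.coord i) x ⊗ₜ[k] b i = x := by
  induction x with
  | zero => simp
  | add x y hx hy =>
    conv_rhs => rw [← hx, ← hy]
    simp [TensorProduct.add_tmul, Finset.sum_add_distrib]
  | tmul a w =>
    conv_rhs => rw [← b.sum_repr w]
    simp only [Module.Dual.baseChange_apply_tmul, Module.Basis.coord_apply,
      TensorProduct.smul_tmul, TensorProduct.tmul_sum]

theorem ext_dual_baseChange [Module.Finite k W] {x y : R ⊗[k] W}
    (h : ∀ ξ : Module.Dual k W, Module.Dual.baseChange R ξ x = Module.Dual.baseChange R ξ y) :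
    x = y := by
  rw [← sum_coord_tmul (Module.finBasis k W) x, ← sum_coord_tmul (Module.finBasis k W) y]
  simp only [h]

variable {ι : Type*} {T : ι → CommAlgCat.{u} k} (f : ∀ i, R →ₐ[k] T i)

/-- If the homomorphisms `f i : R → T i` are jointly injective, then so are the maps
`R ⊗ W → T i ⊗ W`. -/
theorem ext_of_rTensor [Module.Finite k W] (hf : ∀ a b, (∀ i, f i a = f i b) → a = b)
    {x y : R ⊗[k] W} (h : ∀ i, LinearMap.rTensor W (f i).toLinearMap x =
      LinearMap.rTensor W (f i).toLinearMap y) : x = y :=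
  ext_dual_baseChange fun ξ => hf _ _ fun i => by
    rw [← dual_baseChange_rTensor, ← dual_baseChange_rTensor, h]

/-- A family of endomorphisms of the `T i ⊗ W` comes from an endomorphism of `R ⊗ W` as soon as
its matrix coefficients come from elements of `R`. -/
theorem exists_endomorphism [Module.Finite k W] (H : ∀ i, T i ⊗[k] W →ₗ[T i] T i ⊗[k] W)
    (hH : ∀ (w : W) (ξ : Module.Dual k W), ∃ a : R, ∀ i,
      f i a = Module.Dual.baseChange (T i) ξ (H i (1 ⊗ₜ w))) :
    ∃ G : R ⊗[k] W →ₗ[R] R ⊗[k] W, ∀ i x,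
      LinearMap.rTensor W (f i).toLinearMap (G x) =
        H i (LinearMap.rTensor W (f i).toLinearMap x) := by
  let b := Module.finBasis k W
  choose a ha using hH
  -- The chosen `a` need not depend linearly on its arguments: only its values on a basis and the
  -- dual basis enter.
  let G : R ⊗[k] W →ₗ[R] R ⊗[k] W := LinearMap.liftBaseChange R
    (b.constr k fun j => ∑ l, a (b j) (b.coord l) ⊗ₜ[k] b l)
  have hb : ∀ i j, LinearMap.rTensor W (f i).toLinearMap (G (1 ⊗ₜ b j)) = H i (1 ⊗ₜ b j) := by
    intro i j
    rw [← sum_coord_tmul b (H i (1 ⊗ₜ b j))]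
    simp [G, ha, b.constr_basis, map_sum]
  refine ⟨G, fun i x => ?_⟩
  induction x with
  | zero => simp
  | add x y hx hy => simp only [map_add, hx, hy]
  | tmul r w =>
    have h1 : ∀ w, LinearMap.rTensor W (f i).toLinearMap (G (1 ⊗ₜ w)) = H i (1 ⊗ₜ w) := by
      intro w
      exact LinearMap.congr_fun (f := LinearMap.rTensor W (f i).toLinearMap ∘ₗ
        G.restrictScalars k ∘ₗ TensorProduct.mk k R W 1)
        (g := (H i).restrictScalars k ∘ₗ TensorProduct.mk k (T i) W 1) (b.ext fun j => hb i j) w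
    have h2 : r ⊗ₜ[k] w = r • ((1 : R) ⊗ₜ[k] w) := by simp [TensorProduct.smul_tmul']
    rw [h2, map_smul, rTensor_algHom_smul, rTensor_algHom_smul, map_smul, h1]
    simp

end coordinates

/-! ### Matrix coefficients of points -/

namespace localNori

open DInf

variable {k K P : Type u} [Field k] [Field K] [Field P] [Algebra K P] [Algebra k P]
  {R S : Type u} [CommRing R] [Algebra k R] [CommRing S] [Algebra k S]

/-- The matrix coefficient `⟨ξ, g w⟩`. -/
def coeff (g : localNori k K P R) (X : DInf k K P) (w : X.W) (ξ : Module.Dual k X.W) : R :=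
  Module.Dual.baseChange R ξ (g.1 X (1 ⊗ₜ w))

theorem map_apply_rTensor (f : R →ₐ[k] S) (g : localNori k K P R) (X : DInf k K P)
    (x : R ⊗[k] X.W) : (map f g).1 X (LinearMap.rTensor X.W f.toLinearMap x) =
      LinearMap.rTensor X.W f.toLinearMap (g.1 X x) :=
  autBaseChange_rTensor f _ _

theorem map_apply_one_tmul (f : R →ₐ[k] S) (g : localNori k K P R) (X : DInf k K P)
    (w : X.W) : (map f g).1 X (1 ⊗ₜ w) = LinearMap.rTensor X.W f.toLinearMap (g.1 X (1 ⊗ₜ w)) := by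
  rw [← map_apply_rTensor]; simp

theorem coeff_map (f : R →ₐ[k] S) (g : localNori k K P R) (X : DInf k K P) (w : X.W)
    (ξ : Module.Dual k X.W) : coeff (map f g) X w ξ = f (coeff g X w ξ) := by
  rw [coeff, map_apply_one_tmul, dual_baseChange_rTensor, coeff]

theorem coeff_naturality (g : localNori k K P R) {X Y : DInf k K P} (f : X ⟶ Y) (w : X.W)
    (ξ : Module.Dual k Y.W) : coeff g Y (f.b w) ξ = coeff g X w (ξ ∘ₗ f.b) := by
  rw [coeff, coeff, ← dual_baseChange_comp, ← g.2.1, LinearMap.baseChange_tmul]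

theorem coeff_prod (g : localNori k K P R) (X Y : DInf k K P) (w : X.W) (w' : Y.W)
    (ξ : Module.Dual k X.W) (ξ' : Module.Dual k Y.W) :
    coeff g (prod X Y) (w, w') (ξ.coprod ξ') = coeff g X w ξ + coeff g Y w' ξ' := by
  have h : ((w, w') : (prod X Y).W) = (inl X Y).b w + (inr X Y).b w' := by simp [inl, inr]
  have h1 := coeff_naturality g (inl X Y) w (ξ.coprod ξ')
  have h2 := coeff_naturality g (inr X Y) w' (ξ.coprod ξ')
  have h3 : (ξ.coprod ξ') ∘ₗ (inl X Y).b = ξ := LinearMap.coprod_inl ξ ξ'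
  have h4 : (ξ.coprod ξ') ∘ₗ (inr X Y).b = ξ' := LinearMap.coprod_inr ξ ξ'
  rw [h3] at h1
  rw [h4] at h2
  rw [← h1, ← h2, h, coeff, TensorProduct.tmul_add, map_add, map_add]
  rfl

theorem coeff_tensor (g : localNori k K P R) (X Y : DInf k K P) (w : X.W) (w' : Y.W)
    (ξ : Module.Dual k X.W) (ξ' : Module.Dual k Y.W) :
    coeff g (X ⊗ Y) (w ⊗ₜ[k] w') (LinearMap.mul' k k ∘ₗ TensorProduct.map ξ ξ') =
      coeff g X w ξ * coeff g Y w' ξ' := by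
  have h := g.2.2.1 X Y (1 ⊗ₜ w) (1 ⊗ₜ w')
  rw [AlgebraTensorModule.distribBaseChange_symm_tmul, mul_one] at h
  refine (congrArg _ h).trans ?_
  exact dual_baseChange_distrib ξ ξ' _ _

theorem coeff_unit (g : localNori k K P R) (c : k) :
    coeff g (𝟙_ (DInf k K P)) c LinearMap.id = algebraMap k R c := by
  rw [coeff, g.2.2.2]
  change Module.Dual.baseChange R (LinearMap.id : k →ₗ[k] k) (1 ⊗ₜ c) = _
  simp [Algebra.algebraMap_eq_smul_one]

/-- The matrix coefficients of `g⁻¹` are matrix coefficients of `g` on the dual object. -/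
theorem baseChange_symm_apply (g : localNori k K P R) (X : DInf k K P) (w : X.W)
    (ξ : Module.Dual k X.W) : Module.Dual.baseChange R ξ ((g.1 X).symm (1 ⊗ₜ w)) =
      coeff g (dual X) ξ (Module.Dual.eval k X.W w) := by
  set y := (g.1 X).symm (1 ⊗ₜ w) with hy
  -- With `y = g⁻¹ w`, invariance of the evaluation pairing gives `⟨ξ, y⟩ = ⟨g ξ, g y⟩ = ⟨g ξ, w⟩`,
  -- as `g` is trivial on the unit object.
  have h1 := g.2.1 _ _ (evaluation X)
    ((AlgebraTensorModule.distribBaseChange k R (dual X).W X.W).symm ((1 ⊗ₜ ξ) ⊗ₜ[R] y))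
  have h2 : ∀ x, g.1 (line k K 1) x = x := g.2.2.2
  have h3 := g.2.2.1 (dual X) X (1 ⊗ₜ ξ) y
  rw [h2] at h1
  change _ = (contractLeft k X.W).baseChange R (g.1 (dual X ⊗ X) _) at h1
  rw [h3] at h1
  have h4 : g.1 X y = 1 ⊗ₜ w := (g.1 X).apply_symm_apply _
  rw [h4] at h1
  change (contractLeft k X.W).baseChange R _ = _ at h1
  rw [contractLeft_baseChange_distrib, one_mul] at h1
  have h5 : ∀ t : R ⊗[k] Module.Dual k X.W, (contractLeft k X.W).baseChange R
      ((AlgebraTensorModule.distribBaseChange k R (Module.Dual k X.W) X.W).symm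
        (t ⊗ₜ[R] (1 ⊗ₜ w))) = Module.Dual.baseChange R (Module.Dual.eval k X.W w) t ⊗ₜ 1 := by
    intro t
    induction t with
    | zero => simp
    | add x y hx hy => simp only [map_add, TensorProduct.add_tmul, hx, hy]
    | tmul a f => rw [contractLeft_baseChange_distrib]; simp
  erw [h5] at h1
  simpa [coeff] using congrArg (TensorProduct.rid k R) h1

theorem coeff_add (g : localNori k K P R) (X : DInf k K P) (w w' : X.W) (ξ : Module.Dual k X.W) :
    coeff g X (w + w') ξ = coeff g X w ξ + coeff g X w' ξ := by
  simp [coeff, TensorProduct.tmul_add]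

theorem coeff_smul (g : localNori k K P R) (X : DInf k K P) (c : k) (w : X.W)
    (ξ : Module.Dual k X.W) : coeff g X (c • w) ξ = c • coeff g X w ξ := by
  rw [coeff, coeff, TensorProduct.tmul_smul, ← algebraMap_smul R c, map_smul, map_smul,
    algebraMap_smul]

/-- A function on the points of `π^L(K/k)` that is a matrix coefficient. -/
def IsCoeff (F : ∀ R : CommAlgCat.{u} k, localNori k K P R → R) : Prop :=
  ∃ (X : DInf k K P) (w : X.W) (ξ : Module.Dual k X.W), ∀ R g, F R g = coeff g X w ξ

end localNori

/-! ### The coordinate ring and the universal point -/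

namespace localNori

open DInf

variable {k K P : Type u} [Field k] [Field K] [Field P] [Algebra K P] [Algebra k P]

theorem IsCoeff.add {F G : ∀ R : CommAlgCat.{u} k, localNori k K P R → R} (hF : IsCoeff F)
    (hG : IsCoeff G) : IsCoeff fun R g => F R g + G R g := by
  obtain ⟨X, w, ξ, h⟩ := hF
  obtain ⟨Y, w', ξ', h'⟩ := hG
  exact ⟨prod X Y, (w, w'), ξ.coprod ξ', fun R g => by simp only [coeff_prod, h, h']⟩

theorem IsCoeff.mul {F G : ∀ R : CommAlgCat.{u} k, localNori k K P R → R} (hF : IsCoeff F)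
    (hG : IsCoeff G) : IsCoeff fun R g => F R g * G R g := by
  obtain ⟨X, w, ξ, h⟩ := hF
  obtain ⟨Y, w', ξ', h'⟩ := hG
  exact ⟨X ⊗ Y, w ⊗ₜ[k] w', LinearMap.mul' k k ∘ₗ TensorProduct.map ξ ξ',
    fun R g => by simp only [coeff_tensor, h, h']⟩

/-- The matrix entries of the points of `π^L(K/k)` on the standard objects. -/
abbrev Entry (k K P : Type u) [Field k] [Field K] [Field P] [Algebra K P] [Algebra k P] : Type u :=
  Σ s : Std k K P, Fin s.n × Fin s.n

/-- Evaluation of polynomials in the matrix entries at a point of `π^L(K/k)`. -/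
def evalEntry {R : Type u} [CommRing R] [Algebra k R] (g : localNori k K P R) :
    MvPolynomial (Entry k K P) k →ₐ[k] R :=
  MvPolynomial.aeval fun x => coeff g x.1.obj (Pi.single x.2.2 1) (LinearMap.proj x.2.1)

/-- Constants are coefficients of the unit object, sums come from direct sums and products from
tensor products. -/
theorem isCoeff_evalEntry (q : MvPolynomial (Entry k K P) k) :
    IsCoeff fun R (g : localNori k K P R) => evalEntry g q := by
  induction q using MvPolynomial.induction_on with
  | C c =>
    refine ⟨𝟙_ (DInf k K P), c, LinearMap.id, fun R g => ?_⟩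
    rw [coeff_unit]
    exact AlgHom.commutes _ _
  | add p q hp hq => simpa only [map_add] using hp.add hq
  | mul_X p x hp =>
    have hx : IsCoeff fun R (g : localNori k K P R) => evalEntry g (MvPolynomial.X x) :=
      ⟨x.1.obj, Pi.single x.2.2 1, LinearMap.proj x.2.1, fun R g => MvPolynomial.aeval_X _ _⟩
    simpa only [map_mul] using hp.mul hx

/-- The polynomials in the matrix entries that vanish on all points of `π^L(K/k)`. -/
def relations (k K P : Type u) [Field k] [Field K] [Field P] [Algebra K P] [Algebra k P] :
    Ideal (MvPolynomial (Entry k K P) k) :=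
  ⨅ x : Σ R : CommAlgCat.{u} k, localNori k K P R, RingHom.ker (evalEntry x.2)

/-- The coordinate ring of `π^L(K/k)`. -/
abbrev CoordRing (k K P : Type u) [Field k] [Field K] [Field P] [Algebra K P] [Algebra k P] :
    Type u :=
  MvPolynomial (Entry k K P) k ⧸ relations k K P

/-- Evaluation of functions at a point of `π^L(K/k)`. -/
def evalAt {R : CommAlgCat.{u} k} (g : localNori k K P R) : CoordRing k K P →ₐ[k] R :=
  Ideal.Quotient.liftₐ (relations k K P) (evalEntry g) fun _ ha =>
    (Ideal.mem_iInf.mp ha ⟨R, g⟩ :)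

theorem evalAt_mk {R : CommAlgCat.{u} k} (g : localNori k K P R)
    (q : MvPolynomial (Entry k K P) k) :
    evalAt g (Ideal.Quotient.mk (relations k K P) q) = evalEntry g q :=
  rfl

theorem ext_evalAt (a b : CoordRing k K P)
    (h : ∀ x : Σ R : CommAlgCat.{u} k, localNori k K P R, evalAt x.2 a = evalAt x.2 b) :
    a = b := by
  obtain ⟨p, rfl⟩ := Ideal.Quotient.mk_surjective a
  obtain ⟨q, rfl⟩ := Ideal.Quotient.mk_surjective b
  refine Ideal.Quotient.eq.mpr (Ideal.mem_iInf.mpr fun x => ?_)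
  rw [RingHom.mem_ker, map_sub, sub_eq_zero]
  exact h x

theorem coeff_std {R : Type u} [CommRing R] [Algebra k R] (g : localNori k K P R) (s : Std k K P)
    (w : Fin s.n → k) (ξ : Module.Dual k (Fin s.n → k)) :
    coeff g s.obj w ξ = ∑ i, ∑ j, algebraMap k R (ξ (Pi.single i 1) * w j) *
      coeff g s.obj (Pi.single j 1) (LinearMap.proj i) := by
  let b := Pi.basisFun k (Fin s.n)
  let B : (Fin s.n → k) →ₗ[k] Module.Dual k (Fin s.n → k) →ₗ[k] R :=
    LinearMap.mk₂ k (fun w ξ => coeff g s.obj w ξ)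
      (fun _ _ _ => coeff_add _ _ _ _ _) (fun _ _ _ => coeff_smul _ _ _ _ _)
      (fun x y z => by simp [coeff]) (fun c x y => by simp [coeff])
  have hw : w = ∑ j, w j • Pi.single j (1 : k) := (b.sum_repr w).symm.trans (by simp [b])
  have hξ : ξ = ∑ i, ξ (Pi.single i 1) • (LinearMap.proj i : Module.Dual k (Fin s.n → k)) := by
    refine LinearMap.ext fun x => ?_
    have hx : x = ∑ j, x j • Pi.single j (1 : k) := (b.sum_repr x).symm.trans (by simp [b])
    conv_lhs => rw [hx]
    simp [mul_comm]
  change B w ξ = ∑ i, ∑ j, _ * B (Pi.single j 1) (LinearMap.proj i)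
  conv_lhs => rw [hw, hξ]
  simp only [map_sum, map_smul, LinearMap.sum_apply, LinearMap.smul_apply]
  refine Finset.sum_congr rfl fun i _ => ?_
  rw [Finset.smul_sum]
  refine Finset.sum_congr rfl fun j _ => ?_
  rw [smul_smul, Algebra.smul_def]

/-- Transport to a standard object by naturality, then expand in its matrix entries. The resulting
polynomial depends on `X`, `w`, `ξ` but not on the point. -/
theorem exists_evalAt_eq_coeff (X : DInf k K P) (w : X.W) (ξ : Module.Dual k X.W) :
    ∃ a : CoordRing k K P, ∀ x : Σ R : CommAlgCat.{u} k, localNori k K P R,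
      evalAt x.2 a = coeff x.2 X w ξ := by
  obtain ⟨s, ⟨e⟩⟩ := exists_std X
  refine ⟨Ideal.Quotient.mk _ (∑ i, ∑ j,
    MvPolynomial.C ((ξ ∘ₗ e.inv.b) (Pi.single i 1) * e.hom.b w j) *
      MvPolynomial.X (⟨s, i, j⟩ : Entry k K P)), fun x => ?_⟩
  have he : (ξ ∘ₗ e.inv.b) ∘ₗ e.hom.b = ξ := by
    rw [LinearMap.comp_assoc, ← comp_b, e.hom_inv_id, id_b, LinearMap.comp_id]
  have h := coeff_naturality x.2 e.hom w (ξ ∘ₗ e.inv.b)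
  rw [he] at h
  rw [← h, coeff_std, evalAt_mk, map_sum]
  refine Finset.sum_congr rfl fun i _ => ?_
  rw [map_sum]
  refine Finset.sum_congr rfl fun j _ => ?_
  rw [map_mul, evalEntry, MvPolynomial.aeval_X, MvPolynomial.aeval_C]

section universal

variable {A : Type u} [CommRing A] [Algebra k A] {ι : Type*} {T : ι → CommAlgCat.{u} k}
  (h : ∀ i, localNori k K P (T i)) (ev : ∀ i, A →ₐ[k] T i)

/-- The matrices of all `h i` glue because their coefficients lie in `A`. The same holds for the
inverses, whose coefficients are coefficients on the dual. That the two glued maps are mutually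
inverse can be tested at each `ev i`. -/
theorem exists_universal_automorphism (hinj : ∀ a b, (∀ i, ev i a = ev i b) → a = b)
    (hev : ∀ (X : DInf k K P) (w : X.W) (ξ : Module.Dual k X.W),
      ∃ a : A, ∀ i, ev i a = coeff (h i) X w ξ) (X : DInf k K P) :
    ∃ G : A ⊗[k] X.W ≃ₗ[A] A ⊗[k] X.W, ∀ i y,
      LinearMap.rTensor X.W (ev i).toLinearMap (G y) =
        (h i).1 X (LinearMap.rTensor X.W (ev i).toLinearMap y) := by
  obtain ⟨G, hG⟩ := exists_endomorphism ev (fun i => ((h i).1 X).toLinearMap)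
    fun w ξ => hev X w ξ
  obtain ⟨H, hH⟩ := exists_endomorphism ev (fun i => ((h i).1 X).symm.toLinearMap) fun w ξ => by
    obtain ⟨a, ha⟩ := hev (dual X) ξ (Module.Dual.eval k X.W w)
    exact ⟨a, fun i => (ha i).trans (baseChange_symm_apply (h i) X w ξ).symm⟩
  have h₁ : G ∘ₗ H = LinearMap.id := LinearMap.ext fun y => ext_of_rTensor ev hinj fun i =>
    (hG i (H y)).trans ((congrArg ((h i).1 X) (hH i y)).trans
      (((h i).1 X).apply_symm_apply _))
  have h₂ : H ∘ₗ G = LinearMap.id := LinearMap.ext fun y => ext_of_rTensor ev hinj fun i =>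
    (hH i (G y)).trans ((congrArg ((h i).1 X).symm (hG i y)).trans
      (((h i).1 X).symm_apply_apply _))
  exact ⟨LinearEquiv.ofLinearMap G H h₁ h₂, hG⟩

/-- A `k`-algebra of functions on a set of points of `π^L(K/k)` that contains the matrix
coefficients carries a point of `π^L(K/k)` that specializes to all points of the set. -/
theorem exists_point_of_coeff (hinj : ∀ a b, (∀ i, ev i a = ev i b) → a = b)
    (hev : ∀ (X : DInf k K P) (w : X.W) (ξ : Module.Dual k X.W),
      ∃ a : A, ∀ i, ev i a = coeff (h i) X w ξ) :
    ∃ g : localNori k K P A, ∀ i, map (ev i) g = h i := by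
  choose G hG using exists_universal_automorphism h ev hinj hev
  refine ⟨⟨G, fun X Y f x => ?_, fun X Y x y => ?_, fun x => ?_⟩, fun i => ?_⟩
  · refine ext_of_rTensor ev hinj fun i => ?_
    rw [hG, ← baseChange_rTensor, (h i).2.1, ← baseChange_rTensor, hG]
  · refine ext_of_rTensor ev hinj fun i => ?_
    refine (hG _ i _).trans ((congrArg ((h i).1 (X ⊗ Y))
      (distrib_symm_rTensor (ev i) x y).symm).trans (((h i).2.2.1 X Y _ _).trans ?_))
    rw [← hG, ← hG]
    exact distrib_symm_rTensor (ev i) (G X x) (G Y y)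
  · refine ext_of_rTensor ev hinj fun i => ?_
    rw [hG, (h i).2.2.2]
  · refine Subtype.ext (funext fun X => LinearEquiv.toLinearMap_injective ?_)
    refine ext_rTensor (ev i) fun x => ?_
    exact (map_apply_rTensor (ev i) ⟨G, _⟩ X x).trans (hG X i x)

end universal

/-- `π^L(K/k)` has a universal point with values in its coordinate ring. -/
theorem exists_universal_point : ∃ g : localNori k K P (CoordRing k K P),
    ∀ (R : CommAlgCat.{u} k) (h : localNori k K P R), map (evalAt h) g = h := by
  obtain ⟨g, hg⟩ := exists_point_of_coeff
    (T := fun x : Σ R : CommAlgCat.{u} k, localNori k K P R => x.1) (fun x => x.2)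
    (fun x => evalAt x.2)    ext_evalAt exists_evalAt_eq_coeff
  exact ⟨g, fun R h => hg ⟨R, h⟩⟩

/-- Existence is evaluation at `h`. For uniqueness, the generators of the coordinate ring are the
matrix entries of the universal point, so their images are forced to be the entries of `h`. -/
theorem isAffineGroupScheme : IsAffineGroupScheme k K P := by
  obtain ⟨g, hg⟩ := exists_universal_point (k := k) (K := K) (P := P)
  refine ⟨CommAlgCat.of k (CoordRing k K P), g, fun R h => ⟨evalAt h, hg R h, fun f hf => ?_⟩⟩
  refine Ideal.Quotient.algHom_ext _ (MvPolynomial.algHom_ext fun x => ?_)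
  have hx : ∀ f : CoordRing k K P →ₐ[k] R, map f g = h →
      f (coeff g x.1.obj (Pi.single x.2.2 1) (LinearMap.proj x.2.1)) =
        coeff h x.1.obj (Pi.single x.2.2 1) (LinearMap.proj x.2.1) := by
    rintro f rfl
    rw [coeff_map]
  have hX : Ideal.Quotient.mk (relations k K P) (MvPolynomial.X x) =
      coeff g x.1.obj (Pi.single x.2.2 1) (LinearMap.proj x.2.1) := by
    refine ext_evalAt _ _ fun z => ?_
    rw [← coeff_map, hg, evalAt_mk]
    exact MvPolynomial.aeval_X _ _
  change f (Ideal.Quotient.mk _ _) = evalAt h (Ideal.Quotient.mk _ _)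
  rw [hX]
  exact (hx f hf).trans (hx _ (hg R h)).symm

/-- Every character of `π^L(K/k)` is a matrix coefficient. -/
theorem isCoeff_character (χ : characters k K P) :
    IsCoeff fun R (g : localNori k K P R) => (χ.1 R g : R) := by
  obtain ⟨g, hg⟩ := exists_universal_point (k := k) (K := K) (P := P)
  obtain ⟨q, hq⟩ := Ideal.Quotient.mk_surjective
    ((χ.1 (CommAlgCat.of k (CoordRing k K P)) g : (CoordRing k K P)ˣ) : CoordRing k K P)
  obtain ⟨X, w, ξ, h⟩ := isCoeff_evalEntry q
  refine ⟨X, w, ξ, fun R y => ?_⟩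
  rw [← h]
  dsimp only
  -- Yoneda: every point `y` is the image of the universal point, so `χ` is determined by its value
  -- there.
  have h1 := χ.2 (CommAlgCat.of k (CoordRing k K P)) R (evalAt y) g
  rw [hg] at h1
  rw [h1, ← evalAt_mk, hq]

end localNori

/-! ### Base change of `ψ` along homomorphisms `P → S` -/

namespace DInf

variable {k K P : Type u} [Field k] [Field K] [Field P] [Algebra K P] [Algebra k P]

theorem tensorψ_distrib (X Y : DInf k K P) (x : P ⊗[K] X.V) (y : P ⊗[K] Y.V) :
    tensorψ X Y ((AlgebraTensorModule.distribBaseChange K P X.V Y.V).symm (x ⊗ₜ[P] y)) =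
      (AlgebraTensorModule.distribBaseChange k P X.W Y.W).symm (X.ψ x ⊗ₜ[P] Y.ψ y) := by
  simp [tensorψ]

variable [Algebra k K] [IsScalarTower k K P]
  {S : Type u} [CommRing S] [Algebra k S] [Algebra K S] [IsScalarTower k K S]

/-- The base change of `ψ` along a homomorphism `f : P → S`. -/
def pullback (f : P →ₐ[K] S) (X : DInf k K P) : S ⊗[K] X.V ≃ₗ[S] S ⊗[k] X.W :=
  letI := f.toRingHom.toAlgebra
  haveI : IsScalarTower K P S := .of_algebraMap_eq fun x => (f.commutes x).symm
  haveI : IsScalarTower k P S :=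
    .of_algebraMap_eq fun x => ((f.restrictScalars k).commutes x).symm
  (AlgebraTensorModule.cancelBaseChange K P S S X.V).symm ≪≫ₗ
    X.ψ.baseChange P S _ _ ≪≫ₗ AlgebraTensorModule.cancelBaseChange k P S S X.W

/-- This determines the pullback, since the image of `P ⊗ V` generates `S ⊗ V` over `S`. Its
compatibility with arrows and tensor products is thereby reduced to that of `ψ`. -/
theorem pullback_rTensor (f : P →ₐ[K] S) (X : DInf k K P) (x : P ⊗[K] X.V) :
    pullback f X (LinearMap.rTensor X.V f.toLinearMap x) =
      LinearMap.rTensor X.W (f.restrictScalars k).toLinearMap (X.ψ x) := by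
  let _ := f.toRingHom.toAlgebra
  have : IsScalarTower K P S := .of_algebraMap_eq fun x => (f.commutes x).symm
  have : IsScalarTower k P S :=
    .of_algebraMap_eq fun x => ((f.restrictScalars k).commutes x).symm
  have h1 : AlgebraTensorModule.cancelBaseChange K P S S X.V (1 ⊗ₜ x) =
      LinearMap.rTensor X.V f.toLinearMap x := by
    induction x with
    | zero => simp
    | add x y hx hy => simp only [TensorProduct.tmul_add, map_add, hx, hy]
    | tmul a v => simp [Algebra.smul_def]; rfl
  have h2 : ∀ y, AlgebraTensorModule.cancelBaseChange k P S S X.W (1 ⊗ₜ y) =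
      LinearMap.rTensor X.W (f.restrictScalars k).toLinearMap y := by
    intro y
    induction y with
    | zero => simp
    | add x y hx hy => simp only [TensorProduct.tmul_add, map_add, hx, hy]
    | tmul a v => simp [Algebra.smul_def]; rfl
  rw [← h1, ← h2]
  change AlgebraTensorModule.cancelBaseChange k P S S X.W (X.ψ.baseChange P S _ _
    ((AlgebraTensorModule.cancelBaseChange K P S S X.V).symm _)) = _
  rw [LinearEquiv.symm_apply_apply]
  rfl

theorem pullback_naturality (f : P →ₐ[K] S) {X Y : DInf k K P} (φ : X ⟶ Y) (x : S ⊗[K] X.V) :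
    pullback f Y (φ.a.baseChange S x) = φ.b.baseChange S (pullback f X x) := by
  refine LinearMap.congr_fun (f := (pullback f Y).toLinearMap ∘ₗ φ.a.baseChange S)
    (g := φ.b.baseChange S ∘ₗ (pullback f X).toLinearMap) (ext_rTensor f fun x => ?_) x
  simp only [LinearMap.comp_apply, LinearEquiv.coe_coe, baseChange_rTensor, pullback_rTensor]
  rw [φ.comm_apply]

theorem pullback_tensor (f : P →ₐ[K] S) (X Y : DInf k K P) (x : S ⊗[K] X.V) (y : S ⊗[K] Y.V) :
    pullback f (tensor X Y)
        ((AlgebraTensorModule.distribBaseChange K S X.V Y.V).symm (x ⊗ₜ[S] y)) =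
      (AlgebraTensorModule.distribBaseChange k S X.W Y.W).symm
        (pullback f X x ⊗ₜ[S] pullback f Y y) := by
  let A : S ⊗[K] X.V →ₗ[S] S ⊗[K] Y.V →ₗ[S] S ⊗[k] (X.W ⊗[k] Y.W) :=
    (TensorProduct.mk S (S ⊗[K] X.V) (S ⊗[K] Y.V)).compr₂
      ((pullback f (tensor X Y)).toLinearMap ∘ₗ
        (AlgebraTensorModule.distribBaseChange K S X.V Y.V).symm.toLinearMap)
  let B : S ⊗[K] X.V →ₗ[S] S ⊗[K] Y.V →ₗ[S] S ⊗[k] (X.W ⊗[k] Y.W) :=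
    ((TensorProduct.mk S (S ⊗[k] X.W) (S ⊗[k] Y.W)).compl₁₂
      (pullback f X).toLinearMap (pullback f Y).toLinearMap).compr₂
        (AlgebraTensorModule.distribBaseChange k S X.W Y.W).symm.toLinearMap
  have hAB : A = B := ext_rTensor f fun s => ext_rTensor f fun t => by
    change pullback f (tensor X Y) ((AlgebraTensorModule.distribBaseChange K S X.V Y.V).symm
        (LinearMap.rTensor _ f.toLinearMap s ⊗ₜ[S] LinearMap.rTensor _ f.toLinearMap t)) =
      (AlgebraTensorModule.distribBaseChange k S X.W Y.W).symm
        (pullback f X (LinearMap.rTensor _ f.toLinearMap s) ⊗ₜ[S]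
          pullback f Y (LinearMap.rTensor _ f.toLinearMap t))
    rw [distrib_symm_rTensor, pullback_rTensor, pullback_rTensor, pullback_rTensor,
      distrib_symm_rTensor, tensorψ_distrib]
  exact LinearMap.congr_fun₂ hAB x y

theorem pullback_line (f : P →ₐ[K] S) (φ : Pˣ) (s : S) (c : K) :
    pullback f (line k K φ) (s ⊗ₜ[K] (c : K)) = (f φ * (c • s)) ⊗ₜ[k] (1 : k) := by
  have h : s ⊗ₜ[K] c = s • LinearMap.rTensor K f.toLinearMap (1 ⊗ₜ[K] c) := by
    simp [TensorProduct.smul_tmul']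
  rw [h, map_smul]
  refine (congrArg (s • ·) (pullback_rTensor f (line k K φ) (1 ⊗ₜ[K] c))).trans ?_
  rw [line_ψ_tmul]
  simp [TensorProduct.smul_tmul', mul_comm, Algebra.smul_def, mul_assoc]

end DInf

namespace localNori

open DInf

variable {k K P : Type u} [Field k] [Field K] [Field P] [Algebra K P] [Algebra k P]
  [Algebra k K] [IsScalarTower k K P]
  {S : Type u} [CommRing S] [Algebra k S] [Algebra K S] [IsScalarTower k K S]

/-- The point of `π^L(K/k)` that compares the base changes of `ψ` along two homomorphisms
`f₁, f₂ : P → S`. -/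
def ofPair (f₁ f₂ : P →ₐ[K] S) : localNori k K P S :=
  ⟨fun X => (pullback f₂ X).symm ≪≫ₗ pullback f₁ X, by
    refine ⟨fun X Y φ x => ?_, fun X Y x y => ?_, fun x => ?_⟩
    · obtain ⟨x, rfl⟩ := (pullback f₂ X).surjective x
      rw [← pullback_naturality, LinearEquiv.trans_apply, LinearEquiv.trans_apply,
        LinearEquiv.symm_apply_apply, LinearEquiv.symm_apply_apply, pullback_naturality]
    · obtain ⟨x, rfl⟩ := (pullback f₂ X).surjective x
      obtain ⟨y, rfl⟩ := (pullback f₂ Y).surjective y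
      rw [← pullback_tensor]
      change pullback f₁ (tensor X Y) ((pullback f₂ (tensor X Y)).symm _) = _
      rw [LinearEquiv.symm_apply_apply, pullback_tensor, LinearEquiv.trans_apply,
        LinearEquiv.trans_apply, LinearEquiv.symm_apply_apply, LinearEquiv.symm_apply_apply]
    · obtain ⟨x, rfl⟩ := (pullback f₂ (𝟙_ (DInf k K P))).surjective x
      rw [LinearEquiv.trans_apply, LinearEquiv.symm_apply_apply]
      refine LinearMap.congr_fun (f := (pullback f₁ (line k K 1)).toLinearMap)
        (g := (pullback f₂ (line k K 1)).toLinearMap) ?_ x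
      -- On the unit object both pullbacks are given by the images of `1 ∈ P`, hence agree.
      refine ext_rTensor (Algebra.ofId K S) fun x => ?_
      induction x with
      | zero => simp only [map_zero]
      | add x y hx hy => simp only [map_add, hx, hy]
      | tmul c d =>
        refine (pullback_line f₁ 1 _ d).trans ((pullback_line f₂ 1 _ d).trans ?_).symm
        simp⟩

theorem ofPair_pullback (f₁ f₂ : P →ₐ[K] S) (X : DInf k K P) (x : S ⊗[K] X.V) :
    (ofPair f₁ f₂).1 X (pullback f₂ X x) = pullback f₁ X x :=
  congrArg (pullback f₁ X) ((pullback f₂ X).symm_apply_apply x)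

end localNori

/-! ### Slices of tensors along linear forms -/

section slices

variable {F M V : Type u} [Field F] [AddCommGroup M] [Module F M] [AddCommGroup V] [Module F V]

/-- The slice `μ ⊗ id : M ⊗ V → V` along a linear form `μ` on `M`. -/
def slice (μ : Module.Dual F M) : M ⊗[F] V →ₗ[F] V :=
  (TensorProduct.lid F V).toLinearMap ∘ₗ LinearMap.rTensor V μ

@[simp]
theorem slice_tmul (μ : Module.Dual F M) (m : M) (v : V) : slice μ (m ⊗ₜ[F] v) = μ m • v := rfl

/-- An element of `M ⊗ V` all of whose slices lie in a subspace `V'` comes from `M ⊗ V'`. -/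
theorem mem_range_lTensor_of_slice (V' : Submodule F V) (x : M ⊗[F] V)
    (h : ∀ μ : Module.Dual F M, slice μ x ∈ V') :
    x ∈ LinearMap.range (LinearMap.lTensor M V'.subtype) := by
  let b := Module.Basis.ofVectorSpace F M
  obtain ⟨c, rfl⟩ := TensorProduct.eq_repr_basis_left b x
  have hc : ∀ i, c i ∈ V' := fun i => by
    classical
    have h1 := h (b.coord i)
    rw [Finsupp.sum, map_sum] at h1
    simp only [slice_tmul, Module.Basis.coord_apply, Module.Basis.repr_self] at h1
    by_cases hi : i ∈ c.support
    · rw [Finset.sum_eq_single_of_mem i hi] at h1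
      · simpa using h1
      · intro j _ hj
        simp [hj]
    · rw [Finsupp.notMem_support_iff.mp hi]
      exact V'.zero_mem
  exact Submodule.sum_mem _ fun i _ => ⟨b i ⊗ₜ ⟨c i, hc i⟩, rfl⟩

theorem dual_baseChange_slice {R W : Type u} [CommRing R] [Algebra F R] [AddCommGroup W]
    [Module F W] (μ : Module.Dual F R) (ξ : Module.Dual F W) (x : R ⊗[F] W) :
    ξ (slice μ x) = μ (Module.Dual.baseChange R ξ x) := by
  induction x with
  | zero => simp
  | add x y hx hy => simp only [map_add, hx, hy]
  | tmul a w => simp [mul_comm]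

end slices

/-! ### The canonical point over `P ⊗_K P` and descent of stable subspaces -/

namespace DInf

open localNori

variable {k K P : Type u} [Field k] [Field K] [Field P] [Algebra K P] [Algebra k P]
  [Algebra k K] [IsScalarTower k K P]

/-- The canonical point of `π^L(K/k)` with values in `P ⊗_K P`. -/
def canonicalPoint (k K P : Type u) [Field k] [Field K] [Field P] [Algebra K P] [Algebra k P]
    [Algebra k K] [IsScalarTower k K P] : localNori k K P (P ⊗[K] P) :=
  ofPair Algebra.TensorProduct.includeLeft Algebra.TensorProduct.includeRight

/-- The map `id ⊗ μ : P ⊗_K P → P`. -/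
def sliceRight (k : Type u) [Field k] [Algebra k P] [Algebra k K] [IsScalarTower k K P]
    (μ : Module.Dual K P) : P ⊗[K] P →ₗ[k] P :=
  ((TensorProduct.rid K P).toLinearMap ∘ₗ LinearMap.lTensor P μ).restrictScalars k

@[simp]
theorem sliceRight_tmul (μ : Module.Dual K P) (a b : P) :
    sliceRight k μ (a ⊗ₜ[K] b) = μ b • a := rfl

/-- An element `c` of `P` with `c ⊗ 1 = 1 ⊗ c` in `P ⊗_K P` lies in `K`. -/
theorem mem_range_algebraMap_of_tmul_eq {c : P} (h : c ⊗ₜ[K] (1 : P) = 1 ⊗ₜ[K] c) :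
    ∃ a : K, algebraMap K P a = c := by
  -- For a `K`-linear retraction `μ` of `K → P`, the map `id ⊗ μ` sends `c ⊗ 1` to `c` and `1 ⊗ c`
  -- to the scalar `μ c`.
  obtain ⟨μ, hμ⟩ := LinearMap.exists_leftInverse_of_injective (Algebra.linearMap K P)
    (LinearMap.ker_eq_bot.mpr (algebraMap K P).injective)
  have h1 : μ 1 = 1 := by simpa using LinearMap.congr_fun hμ 1
  have h2 := congrArg (sliceRight K μ) h
  rw [sliceRight_tmul, sliceRight_tmul, h1, one_smul] at h2
  exact ⟨μ c, (Algebra.algebraMap_eq_smul_one _).trans h2.symm⟩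

theorem rTensor_sliceRight_smul {W : Type u} [AddCommGroup W] [Module k W] (μ : Module.Dual K P)
    (p : P) (z : P ⊗[k] W) :
    LinearMap.rTensor W (sliceRight k μ) (((1 : P) ⊗ₜ[K] p) • LinearMap.rTensor W
      ((Algebra.TensorProduct.includeLeft : P →ₐ[K] P ⊗[K] P).restrictScalars k).toLinearMap z) =
      (μ p • (1 : P)) • z := by
  induction z with
  | zero => simp
  | add x y hx hy => simp only [map_add, smul_add, hx, hy]
  | tmul q w => simp [TensorProduct.smul_tmul']

/-- The pullback along the left inclusion is linear over the right factor of `P ⊗_K P`, so it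
commutes with applying `μ` to that factor. -/
theorem rTensor_sliceRight_pullback (X : DInf k K P) (μ : Module.Dual K P) (y : P ⊗[K] X.V) :
    LinearMap.rTensor X.W (sliceRight k μ) (pullback Algebra.TensorProduct.includeLeft X
      (LinearMap.rTensor X.V
        (Algebra.TensorProduct.includeRight : P →ₐ[K] P ⊗[K] P).toLinearMap y)) =
      X.ψ (1 ⊗ₜ[K] slice μ y) := by
  induction y with
  | zero => simp
  | add x y hx hy => simp only [map_add, TensorProduct.tmul_add, hx, hy]
  | tmul p v =>
    have h : LinearMap.rTensor X.V
        (Algebra.TensorProduct.includeRight : P →ₐ[K] P ⊗[K] P).toLinearMap (p ⊗ₜ v) =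
        ((1 : P) ⊗ₜ[K] p) • LinearMap.rTensor X.V
          (Algebra.TensorProduct.includeLeft : P →ₐ[K] P ⊗[K] P).toLinearMap (1 ⊗ₜ v) := by
      simp [TensorProduct.smul_tmul']
    rw [h, map_smul, pullback_rTensor, rTensor_sliceRight_smul, slice_tmul, ψ_smul]

/-- The formula behind descent: slices of the canonical action on `w` compute `ψ` on the slices of
`ψ⁻¹(1 ⊗ w)`. Stability of a subspace of `W` thus controls vectors of `V`. -/
theorem rTensor_sliceRight_canonicalPoint (X : DInf k K P) (μ : Module.Dual K P) (w : X.W) :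
    LinearMap.rTensor X.W (sliceRight k μ) ((canonicalPoint k K P).1 X (1 ⊗ₜ w)) =
      X.ψ (1 ⊗ₜ[K] slice μ (X.ψ.symm (1 ⊗ₜ w))) := by
  have h := ofPair_pullback Algebra.TensorProduct.includeLeft
    (Algebra.TensorProduct.includeRight : P →ₐ[K] P ⊗[K] P) X
    (LinearMap.rTensor X.V Algebra.TensorProduct.includeRight.toLinearMap (X.ψ.symm (1 ⊗ₜ w)))
  rw [pullback_rTensor, LinearEquiv.apply_symm_apply] at h
  rw [← rTensor_sliceRight_pullback, ← h, LinearMap.rTensor_tmul, AlgHom.toLinearMap_apply, map_one]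
  rfl

/-- The subspace of `V` of the elements `v` with `ψ (1 ⊗ v) ∈ P ⊗ U`. -/
def descend (X : DInf k K P) (U : Submodule k X.W) : Submodule K X.V where
  carrier := {v | X.ψ (1 ⊗ₜ[K] v) ∈ LinearMap.range (U.subtype.baseChange P)}
  add_mem' {v v'} hv hv' := by
    simp only [Set.mem_ofPred_eq, TensorProduct.tmul_add, map_add]
    exact add_mem hv hv'
  zero_mem' := ⟨0, by simp⟩
  smul_mem' c v hv := by
    simp only [Set.mem_ofPred_eq, ψ_smul]
    exact Submodule.smul_mem _ _ hv

theorem baseChange_subtype_injective {F M : Type u} [Field F] [Algebra F P] [AddCommGroup M]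
    [Module F M] (N : Submodule F M) : Function.Injective (N.subtype.baseChange P) := by
  rw [LinearMap.baseChange_eq_ltensor]
  exact Module.Flat.lTensor_preserves_injective_linearMap _ N.injective_subtype

/-- A subspace of `W` that is stable under the canonical point is descended by `descend`. -/
theorem range_descend (X : DInf k K P) (U : Submodule k X.W)
    (hU : ∀ w ∈ U, (canonicalPoint k K P).1 X (1 ⊗ₜ w) ∈
      LinearMap.range (LinearMap.lTensor (P ⊗[K] P) U.subtype)) :
    LinearMap.range (X.ψ.toLinearMap ∘ₗ (X.descend U).subtype.baseChange P) =
      LinearMap.range (U.subtype.baseChange P) := by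
  apply le_antisymm
  · rintro _ ⟨x, rfl⟩
    induction x with
    | zero => simp
    | add x y hx hy => rw [map_add]; exact add_mem hx hy
    | tmul p v =>
      have h : p ⊗ₜ[K] v = p • ((1 : P) ⊗ₜ[K] v) := by simp [TensorProduct.smul_tmul']
      rw [h, map_smul]
      exact Submodule.smul_mem _ _ v.2
  · rintro _ ⟨x, rfl⟩
    induction x with
    | zero => simp
    | add x y hx hy => rw [map_add]; exact add_mem hx hy
    | tmul p u =>
      have h : p ⊗ₜ[k] u = p • ((1 : P) ⊗ₜ[k] u) := by simp [TensorProduct.smul_tmul']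
      rw [h, map_smul]
      refine Submodule.smul_mem _ _ ?_
      rw [LinearMap.baseChange_tmul]
      -- If every slice of `ψ⁻¹(1 ⊗ u)` lies in the descended subspace, then `ψ⁻¹(1 ⊗ u)` comes from
      -- its base change to `P`.
      have hs : ∀ μ : Module.Dual K P, slice μ (X.ψ.symm (1 ⊗ₜ (u : X.W))) ∈ X.descend U := by
        intro μ
        change X.ψ _ ∈ LinearMap.range (U.subtype.baseChange P)
        rw [← rTensor_sliceRight_canonicalPoint]
        obtain ⟨t, ht⟩ := hU u u.2
        rw [← ht]
        refine ⟨LinearMap.rTensor U (sliceRight k μ) t, ?_⟩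
        rw [LinearMap.baseChange_eq_ltensor, ← LinearMap.comp_apply, ← LinearMap.comp_apply,
          LinearMap.lTensor_comp_rTensor, LinearMap.rTensor_comp_lTensor]
      obtain ⟨t, ht⟩ := mem_range_lTensor_of_slice _ _ hs
      refine ⟨t, ?_⟩
      rw [LinearMap.comp_apply, LinearMap.baseChange_eq_ltensor, ht]
      exact X.ψ.apply_symm_apply _

/-- A subspace of `W` that is stable under the canonical point underlies a subobject. -/
theorem exists_subobject (X : DInf k K P) (U : Submodule k X.W)
    (hU : ∀ w ∈ U, (canonicalPoint k K P).1 X (1 ⊗ₜ w) ∈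
      LinearMap.range (LinearMap.lTensor (P ⊗[K] P) U.subtype)) :
    ∃ (Y : DInf k K P) (f : Y ⟶ X), LinearMap.range f.b = U := by
  let i : P ⊗[K] X.descend U →ₗ[P] P ⊗[k] X.W :=
    X.ψ.toLinearMap ∘ₗ (X.descend U).subtype.baseChange P
  let j : P ⊗[k] U →ₗ[P] P ⊗[k] X.W := U.subtype.baseChange P
  have hi : Function.Injective i := X.ψ.injective.comp (baseChange_subtype_injective _)
  have hj : Function.Injective j := baseChange_subtype_injective _
  let ψ' : P ⊗[K] X.descend U ≃ₗ[P] P ⊗[k] U :=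
    LinearEquiv.ofInjective i hi ≪≫ₗ LinearEquiv.ofEq _ _ (range_descend X U hU) ≪≫ₗ
      (LinearEquiv.ofInjective j hj).symm
  have hψ : ∀ x, j (ψ' x) = i x := fun x => by
    change (LinearEquiv.ofInjective j hj ((LinearEquiv.ofInjective j hj).symm
      (LinearEquiv.ofEq _ _ (range_descend X U hU) (LinearEquiv.ofInjective i hi x))) :
        P ⊗[k] X.W) = _
    rw [LinearEquiv.apply_symm_apply]
    rfl
  refine ⟨{ V := X.descend U, W := U, ψ := ψ' }, ⟨(X.descend U).subtype, U.subtype,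
    LinearMap.ext fun x => (hψ x).symm⟩, U.range_subtype⟩

end DInf

/-! ### Characters of lines, and every character as one of them -/

namespace localNori

open DInf

variable {k K P : Type u} [Field k] [Field K] [Field P] [Algebra K P] [Algebra k P]
  {R S : Type u} [CommRing R] [Algebra k R] [CommRing S] [Algebra k S]

theorem apply_line (g : localNori k K P R) (φ : Pˣ) (x : R ⊗[k] k) :
    g.1 (line k K φ) x = coeff g (line k K φ) (1 : k) LinearMap.id • x := by
  have h1 : ∀ y : R ⊗[k] k, y = Module.Dual.baseChange R (LinearMap.id : k →ₗ[k] k) y ⊗ₜ 1 := by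
    intro y
    induction y with
    | zero => simp
    | add x y hx hy => rw [map_add, TensorProduct.add_tmul, ← hx, ← hy]
    | tmul a c => simp [TensorProduct.smul_tmul]
  have h2 : x = Module.Dual.baseChange R (LinearMap.id : k →ₗ[k] k) x • ((1 : R) ⊗ₜ[k] (1 : k)) := by
    rw [TensorProduct.smul_tmul', smul_eq_mul, mul_one]
    exact h1 x
  have h3 : g.1 (line k K φ) (1 ⊗ₜ[k] (1 : k)) =
      coeff g (line k K φ) (1 : k) LinearMap.id • ((1 : R) ⊗ₜ[k] (1 : k)) := by
    rw [TensorProduct.smul_tmul', smul_eq_mul, mul_one]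
    exact h1 _
  rw [h2, map_smul, h3, smul_comm]

/-- The scalar by which a point of `π^L(K/k)` acts on the line `ω(K, k, φ)`. -/
def lineCharacterHom (φ : Pˣ) : localNori k K P R →* R where
  toFun g := coeff g (line k K φ) (1 : k) LinearMap.id
  map_one' := by
    change Module.Dual.baseChange R (LinearMap.id : k →ₗ[k] k) (1 ⊗ₜ 1) = 1
    simp
  map_mul' g h := by
    change Module.Dual.baseChange R (LinearMap.id : k →ₗ[k] k)
      (g.1 (line k K φ) (h.1 (line k K φ) _)) = _
    rw [apply_line, map_smul]
    rfl

/-- The character through which `π^L(K/k)` acts on the line `ω(K, k, φ)`. -/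
def lineCharacter (φ : Pˣ) : characters k K P :=
  ⟨fun _ => (lineCharacterHom φ).toHomUnits, fun _ _ f g => coeff_map f g _ _ _⟩

theorem lineCharacter_val (φ : Pˣ) (R : CommAlgCat.{u} k) (g : localNori k K P R) :
    (((lineCharacter φ).1 R g : Rˣ) : R) = coeff g (line k K φ) (1 : k) LinearMap.id :=
  rfl

theorem characters_ext {χ χ' : characters k K P}
    (h : ∀ (R : CommAlgCat.{u} k) (g : localNori k K P R), (χ.1 R g : R) = χ'.1 R g) : χ = χ' :=
  Subtype.ext <| funext fun R => MonoidHom.ext fun g => Units.ext (h R g)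

/-- `π^L(K/k)` acts on any object isomorphic to `(K, k, φ)` through the same character. -/
theorem apply_of_iso_line {X : DInf k K P} {φ : Pˣ} (e : X ≅ line k K φ) (R : CommAlgCat.{u} k)
    (g : localNori k K P R) (x : R ⊗[k] X.W) :
    g.1 X x = ((lineCharacter φ).1 R g : R) • x := by
  have h0 : (Hom.b e.inv).baseChange R ∘ₗ (Hom.b e.hom).baseChange R = LinearMap.id := by
    rw [← LinearMap.baseChange_comp, ← comp_b, e.hom_inv_id, id_b, LinearMap.baseChange_id]
  have h1 := g.2.1 _ _ e.inv ((Hom.b e.hom).baseChange R x)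
  have h2 : (Hom.b e.inv).baseChange R ((Hom.b e.hom).baseChange R x) = x :=
    LinearMap.congr_fun h0 x
  rw [h2, apply_line, map_smul, h2] at h1
  exact h1

theorem lineCharacter_eq_of_iso {φ φ' : Pˣ} (e : line k K φ ≅ line k K φ') :
    (lineCharacter φ : characters k K P) = lineCharacter φ' :=
  characters_ext fun R g => by
    rw [lineCharacter_val, coeff, apply_of_iso_line e]
    simp

/-- `(K, k, φ) ⊗ (K, k, φ') ≅ (K, k, φ φ')`. -/
def lineTensorIso (φ φ' : Pˣ) : line k K φ ⊗ line k K φ' ≅ line k K (φ * φ') :=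
  mkIso (TensorProduct.lid K K) (TensorProduct.lid k k) (by
    refine baseChange_tensor_ext fun (c : K) (c' : K) => ?_
    change (line k K (φ * φ')).ψ (1 ⊗ₜ[K] (c • c')) =
      (TensorProduct.lid k k).toLinearMap.baseChange P
        (tensorψ (line k K φ) (line k K φ') (1 ⊗ₜ[K] (c ⊗ₜ[K] c')))
    rw [tensorψ_tmul, line_ψ_tmul, line_ψ_tmul, line_ψ_tmul]
    refine Eq.trans ?_ (lid_baseChange_distrib _ _).symm
    rw [TensorProduct.smul_tmul']
    congr 1
    simp [Algebra.smul_def]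
    ring)

theorem lineCharacter_mul (φ φ' : Pˣ) :
    (lineCharacter (φ * φ') : characters k K P) = lineCharacter φ * lineCharacter φ' :=
  characters_ext fun R g => by
    have h := coeff_tensor g (line k K φ) (line k K φ') (1 : k) (1 : k) LinearMap.id LinearMap.id
    rw [coeff, apply_of_iso_line (lineTensorIso φ φ'), map_smul] at h
    have h1 : Module.Dual.baseChange R (LinearMap.mul' k k ∘ₗ TensorProduct.map LinearMap.id
        LinearMap.id) ((1 : R) ⊗ₜ[k] ((1 : k) ⊗ₜ[k] (1 : k))) = 1 := by simp
    exact ((congrArg (_ • ·) h1).trans (mul_one _)).symm.trans h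


/-- Slices of the matrix coefficients of a product of two points over `S ⊗ R`. -/
theorem slice_coeff_mul {R S : Type u} [CommRing R] [Algebra k R] [CommRing S] [Algebra k S]
    (γ : localNori k K P S) (g : localNori k K P R) (μ : Module.Dual k S) (X : DInf k K P)
    (w : X.W) (ξ : Module.Dual k X.W) :
    slice μ (coeff (map (Algebra.TensorProduct.includeRight : R →ₐ[k] S ⊗[k] R) g *
      map Algebra.TensorProduct.includeLeft γ) X w ξ) =
      coeff g X (slice μ (γ.1 X (1 ⊗ₜ w))) ξ := by
  let i₁ : S →ₐ[k] S ⊗[k] R := Algebra.TensorProduct.includeLeft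
  let i₂ : R →ₐ[k] S ⊗[k] R := Algebra.TensorProduct.includeRight
  have h1 : ∀ x : S ⊗[k] X.W,
      slice μ (Module.Dual.baseChange (S ⊗[k] R) ξ
        ((map i₂ g).1 X (LinearMap.rTensor X.W i₁.toLinearMap x))) =
        coeff g X (slice μ x) ξ := by
    intro x
    induction x with
    | zero => simp [coeff]
    | add x y hx hy => simp only [map_add, hx, hy, coeff_add]
    | tmul s w =>
      have hs : LinearMap.rTensor X.W i₁.toLinearMap (s ⊗ₜ w) =
          i₁ s • ((1 : S ⊗[k] R) ⊗ₜ[k] w) := by simp [TensorProduct.smul_tmul']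
      have hc := coeff_map i₂ g X w ξ
      rw [coeff] at hc
      rw [hs, map_smul, map_smul, hc, slice_tmul, coeff_smul]
      simp [i₁, i₂]
  rw [← h1, ← map_apply_one_tmul]
  rfl

/-- Taking the two points over different tensor factors makes the value of `χ` on their product a
pure tensor, whose slices are multiples of `χ(g)`. -/
theorem character_mul_includeRight_includeLeft (χ : characters k K P) {R S : CommAlgCat.{u} k}
    (γ : localNori k K P S) (g : localNori k K P R) :
    ((χ.1 (CommAlgCat.of k (S ⊗[k] R)) (map Algebra.TensorProduct.includeRight g *
      map Algebra.TensorProduct.includeLeft γ) : (S ⊗[k] R)ˣ) : S ⊗[k] R) =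
      (χ.1 S γ : S) ⊗ₜ[k] (χ.1 R g : R) := by
  have e1 := χ.2 S (CommAlgCat.of k (S ⊗[k] R)) Algebra.TensorProduct.includeLeft γ
  have e2 := χ.2 R (CommAlgCat.of k (S ⊗[k] R)) Algebra.TensorProduct.includeRight g
  rw [map_mul, Units.val_mul]
  refine (congrArg₂ (· * ·) e2 e1).trans ?_
  change ((1 : S) ⊗ₜ[k] (χ.1 R g : R)) * ((χ.1 S γ : S) ⊗ₜ[k] (1 : R)) = _
  rw [Algebra.TensorProduct.tmul_mul_tmul, one_mul, mul_one]

/-- For a character that is the matrix coefficient of `w` and `ξ`, the vectors on which `ξ`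
transforms through the character. -/
def eigenspace (χ : characters k K P) (X : DInf k K P) (ξ : Module.Dual k X.W) :
    Submodule k X.W where
  carrier := {w | ∀ (R : CommAlgCat.{u} k) (g : localNori k K P R),
    coeff g X w ξ = ξ w • (χ.1 R g : R)}
  add_mem' hv hw R g := by rw [coeff_add, hv, hw, map_add, add_smul]
  zero_mem' R g := by simp [coeff]
  smul_mem' c w hw R g := by rw [coeff_smul, hw, map_smul, smul_assoc]

/-- This is `⟨ξ, g γ w⟩ = ξ(w) χ(γ) χ(g)` sliced along `μ`, combined with `⟨ξ, γ w⟩ = ξ(w) χ(γ)`. -/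
theorem slice_mem_eigenspace (χ : characters k K P) (X : DInf k K P) (ξ : Module.Dual k X.W)
    {S : CommAlgCat.{u} k} (γ : localNori k K P S) (μ : Module.Dual k S) {w : X.W}
    (hw : w ∈ eigenspace χ X ξ) : slice μ (γ.1 X (1 ⊗ₜ w)) ∈ eigenspace χ X ξ := by
  intro R g
  have h2 := hw (CommAlgCat.of k (S ⊗[k] R))
    (map Algebra.TensorProduct.includeRight g * map Algebra.TensorProduct.includeLeft γ)
  rw [character_mul_includeRight_includeLeft] at h2
  have h5 := hw S γ
  rw [coeff] at h5
  rw [← slice_coeff_mul, dual_baseChange_slice, h5]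
  refine (congrArg (slice μ) h2).trans ?_
  rw [map_smul, map_smul, slice_tmul, smul_assoc]

variable [Algebra k K] [IsScalarTower k K P]

/-- The canonical point carries the right pullback of `1 ⊗ v` to the left one. Pairing with `ξ`,
which transforms through `u`, gives the relation. -/
theorem canonicalPoint_dual {X : DInf k K P} {ξ : Module.Dual k X.W} {u : P ⊗[K] P}
    (h : ∀ w, coeff (canonicalPoint k K P) X w ξ = ξ w • u) (v : X.V) :
    Module.Dual.baseChange P ξ (X.ψ (1 ⊗ₜ v)) ⊗ₜ[K] (1 : P) =
      u * (1 ⊗ₜ[K] Module.Dual.baseChange P ξ (X.ψ (1 ⊗ₜ v))) := by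
  have h1 : ∀ z : (P ⊗[K] P) ⊗[k] X.W,
      Module.Dual.baseChange (P ⊗[K] P) ξ ((canonicalPoint k K P).1 X z) =
        u * Module.Dual.baseChange (P ⊗[K] P) ξ z := by
    intro z
    induction z with
    | zero => simp
    | add x y hx hy => simp only [map_add, mul_add, hx, hy]
    | tmul s w =>
      have hs : s ⊗ₜ[k] w = s • ((1 : P ⊗[K] P) ⊗ₜ[k] w) := by simp [TensorProduct.smul_tmul']
      have hw := h w
      rw [coeff] at hw
      rw [hs, map_smul, map_smul, map_smul, hw]
      simp [mul_comm]
  have h2 : ∀ f : P →ₐ[K] P ⊗[K] P,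
      Module.Dual.baseChange (P ⊗[K] P) ξ (pullback f X (1 ⊗ₜ v)) =
        f (Module.Dual.baseChange P ξ (X.ψ (1 ⊗ₜ v))) := by
    intro f
    have hf := pullback_rTensor f X (1 ⊗ₜ v)
    rw [LinearMap.rTensor_tmul, AlgHom.toLinearMap_apply, map_one] at hf
    rw [hf, dual_baseChange_rTensor]
    rfl
  have h3 := h1 (pullback Algebra.TensorProduct.includeRight X (1 ⊗ₜ v))
  rw [canonicalPoint, ofPair_pullback, h2, h2] at h3
  exact h3

/-- The line `(K, k, φ)` has trivial character only if `φ ∈ K^*`. -/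
theorem mem_of_lineCharacter_eq_one {φ : Pˣ} (h : (lineCharacter φ : characters k K P) = 1) :
    ∃ c : K, algebraMap K P c = φ := by
  have h1 : coeff (canonicalPoint k K P) (line k K φ) (1 : k) LinearMap.id = 1 := by
    have h2 := lineCharacter_val φ (CommAlgCat.of k (P ⊗[K] P)) (canonicalPoint k K P)
    rw [h] at h2
    exact h2.symm
  have h3 := canonicalPoint_dual (X := line k K φ) (ξ := (LinearMap.id : k →ₗ[k] k)) (u := 1)
    (fun w : k => by
      rw [coeff, apply_line, h1, one_smul]
      simp) (1 : K)
  have h4 : Module.Dual.baseChange P (LinearMap.id : k →ₗ[k] k)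
      ((line k K φ).ψ (1 ⊗ₜ[K] (1 : K))) = φ := by
    rw [line_ψ_tmul]
    simp
  rw [h4, one_mul] at h3
  exact mem_range_algebraMap_of_tmul_eq h3

/-- If `π^L(K/k)` acts through a scalar on a nonzero quotient `ξ` of `ω(X)`, then `ξ` underlies
a morphism onto some `(K, k, φ)`. -/
theorem exists_hom_line {X : DInf k K P} {ξ : Module.Dual k X.W} {u : P ⊗[K] P}
    (h : ∀ w, coeff (canonicalPoint k K P) X w ξ = ξ w • u) (hξ : ξ ≠ 0) :
    ∃ (φ : Pˣ) (f : X ⟶ line k K φ), f.b = ξ := by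
  have hu := canonicalPoint_dual h
  obtain ⟨l, hl⟩ : ∃ l : X.V → P, ∀ v, Module.Dual.baseChange P ξ (X.ψ (1 ⊗ₜ v)) = l v :=
    ⟨_, fun _ => rfl⟩
  simp only [hl] at hu
  have hl0 : ∃ v, l v ≠ 0 := by
    -- If `l` vanished on `V`, then `ξ` would vanish on the image of `ψ`, which is all of `P ⊗ W`.
    by_contra! h0
    refine hξ (LinearMap.ext fun w => ?_)
    have h1 : ∀ y, Module.Dual.baseChange P ξ (X.ψ y) = 0 := by
      intro y
      induction y with
      | zero => simp
      | add x y hx hy => rw [map_add, map_add, hx, hy, add_zero]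
      | tmul p v =>
        have hp : p ⊗ₜ[K] v = p • ((1 : P) ⊗ₜ[K] v) := by simp [TensorProduct.smul_tmul']
        rw [hp, map_smul, map_smul]
        rw [hl, h0, smul_zero]
    have h2 := h1 (X.ψ.symm (1 ⊗ₜ w))
    rw [LinearEquiv.apply_symm_apply] at h2
    simpa using h2
  obtain ⟨v₀, hv₀⟩ := hl0
  -- The relation at `v₀` forces `u = (l v₀ ⊗ 1)(1 ⊗ (l v₀)⁻¹)`. Substituted into the relation at
  -- `v`, it shows that `l v / l v₀` has equal images under the two inclusions.
  have hK : ∀ v, ∃ c : K, algebraMap K P c = l v / l v₀ := by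
    intro v
    apply mem_range_algebraMap_of_tmul_eq
    have e1 : (l v / l v₀) ⊗ₜ[K] (1 : P) = l v ⊗ₜ[K] 1 * (l v₀)⁻¹ ⊗ₜ[K] 1 := by
      simp [div_eq_mul_inv]
    have e2 : l v₀ ⊗ₜ[K] (1 : P) * (1 ⊗ₜ[K] (l v₀)⁻¹) = u := by
      rw [hu v₀, mul_assoc]
      rw [Algebra.TensorProduct.tmul_mul_tmul, one_mul, mul_inv_cancel₀ hv₀,
        ← Algebra.TensorProduct.one_def, mul_one]
    rw [e1, hu v, ← e2]
    simp [hv₀, div_eq_mul_inv, mul_comm]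
  choose c hc using hK
  have hinj := (algebraMap K P).injective
  let a : X.V →ₗ[K] K :=
    { toFun := c
      map_add' := fun v v' => hinj (by
        rw [map_add, hc, hc, hc, ← add_div]
        simp [← hl, TensorProduct.tmul_add])
      map_smul' := fun r v => hinj (by
        rw [RingHom.id_apply, smul_eq_mul, map_mul, hc, hc, ← mul_div_assoc]
        rw [← hl, ψ_smul, map_smul, hl, smul_eq_mul, Algebra.algebraMap_eq_smul_one]) }
  refine ⟨Units.mk0 (l v₀) hv₀, ⟨a, ξ, ?_⟩, rfl⟩
  ext v
  change (line k K (Units.mk0 (l v₀) hv₀)).ψ (1 ⊗ₜ[K] c v) = LinearMap.baseChange P ξ (X.ψ (1 ⊗ₜ v))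
  rw [line_ψ_tmul, Units.val_mk0, ← Algebra.algebraMap_eq_smul_one, hc, mul_div_cancel₀ _ hv₀]
  apply (AlgebraTensorModule.rid k P P).injective
  rw [← hl, AlgebraTensorModule.rid_tmul, one_smul]
  rfl

/-- Every character of `π^L(K/k)` is the character of some `(K, k, φ)`. -/
theorem lineCharacter_surjective :
    Function.Surjective (lineCharacter : Pˣ → characters k K P) := by
  intro χ
  obtain ⟨X, w, ξ, hχ⟩ := isCoeff_character χ
  dsimp only at hχ
  -- Evaluation at the identity point over `k`, where `χ` takes the value `1`.
  have hξw : ξ w = 1 := by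
    have h := hχ (CommAlgCat.of k k) 1
    rw [map_one, Units.val_one] at h
    change 1 = Module.Dual.baseChange k ξ (1 ⊗ₜ w) at h
    simpa using h.symm
  have hw : w ∈ eigenspace χ X ξ := fun R g => by rw [← hχ, hξw, one_smul]
  obtain ⟨Y, f, hf⟩ := X.exists_subobject (eigenspace χ X ξ) fun v hv =>
    mem_range_lTensor_of_slice _ _ fun μ =>
      slice_mem_eigenspace χ X ξ (S := CommAlgCat.of k (P ⊗[K] P)) (canonicalPoint k K P) μ hv
  have hY : ∀ (R : CommAlgCat.{u} k) (g : localNori k K P R) (y : Y.W),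
      coeff g Y y (ξ ∘ₗ f.b) = (ξ ∘ₗ f.b) y • (χ.1 R g : R) := by
    intro R g y
    rw [← coeff_naturality]
    have hy : f.b y ∈ eigenspace χ X ξ := hf ▸ LinearMap.mem_range_self f.b y
    exact hy R g
  obtain ⟨y, hy⟩ : w ∈ LinearMap.range f.b := hf ▸ hw
  have hξy : (ξ ∘ₗ f.b) y = 1 := by rw [LinearMap.comp_apply, hy, hξw]
  obtain ⟨φ, e, he⟩ := exists_hom_line (hY (CommAlgCat.of k (P ⊗[K] P)) (canonicalPoint k K P))
    (fun h => by simp [h] at hξy)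
  refine ⟨φ, characters_ext fun R g => ?_⟩
  -- The vector `y` maps to `1` in the line, so naturality along `e` identifies the character of
  -- `(K, k, φ)` with `χ`.
  have h := coeff_naturality g e y (LinearMap.id : k →ₗ[k] k)
  rw [he, hξy, LinearMap.id_comp, hY, hξy, one_smul] at h
  exact h

end localNori

/-! ### Invertible objects and the Picard group -/

namespace DInf

open localNori

variable {k K P : Type u} [Field k] [Field K] [Field P] [Algebra K P] [Algebra k P]

/-- An object of rank one is isomorphic to some `(K, k, φ)`. -/
theorem exists_iso_line (X : DInf k K P) (a : X.V ≃ₗ[K] K) (b : X.W ≃ₗ[k] k) :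
    ∃ φ : Pˣ, Nonempty (X ≅ line k K φ) := by
  -- In the coordinates `a` and `b`, `ψ` becomes a `P`-linear automorphism of `P`, that is,
  -- multiplication by `φ = e 1`.
  let e : P ≃ₗ[P] P := (AlgebraTensorModule.rid K P P).symm ≪≫ₗ (a.baseChange K P X.V K).symm ≪≫ₗ
    X.ψ ≪≫ₗ b.baseChange k P X.W k ≪≫ₗ AlgebraTensorModule.rid k P P
  have he : ∀ p, e p = p * e 1 := fun p => by
    rw [← smul_eq_mul, ← map_smul, smul_eq_mul, mul_one]
  have he0 : e 1 ≠ 0 := by simp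
  refine ⟨Units.mk0 (e 1) he0, ⟨mkIso a b ?_⟩⟩
  ext v
  change (line k K (Units.mk0 (e 1) he0)).ψ (1 ⊗ₜ[K] a v) = b.baseChange k P X.W k (X.ψ (1 ⊗ₜ v))
  have h1 : e (a v • 1) =
      AlgebraTensorModule.rid k P P (b.baseChange k P X.W k (X.ψ (1 ⊗ₜ v))) := by
    have h2 : (a.baseChange K P X.V K).symm ((AlgebraTensorModule.rid K P P).symm (a v • 1)) =
        1 ⊗ₜ v := by
      rw [LinearEquiv.symm_apply_eq, LinearEquiv.symm_apply_eq]
      rfl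
    change AlgebraTensorModule.rid k P P (b.baseChange k P X.W k (X.ψ
      ((a.baseChange K P X.V K).symm ((AlgebraTensorModule.rid K P P).symm (a v • 1))))) = _
    rw [h2]
  apply (AlgebraTensorModule.rid k P P).injective
  rw [← h1, line_ψ_tmul, AlgebraTensorModule.rid_tmul, one_smul, Units.val_mk0,
    he (a v • 1), mul_comm]

/-- The underlying linear isomorphisms of an isomorphism. -/
def isoV {X Y : DInf k K P} (e : X ≅ Y) : X.V ≃ₗ[K] Y.V :=
  LinearEquiv.ofLinearMap (Hom.a e.hom) (Hom.a e.inv)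
    (by rw [← comp_a, e.inv_hom_id, id_a]) (by rw [← comp_a, e.hom_inv_id, id_a])

def isoW {X Y : DInf k K P} (e : X ≅ Y) : X.W ≃ₗ[k] Y.W :=
  LinearEquiv.ofLinearMap (Hom.b e.hom) (Hom.b e.inv)
    (by rw [← comp_b, e.inv_hom_id, id_b]) (by rw [← comp_b, e.hom_inv_id, id_b])

theorem finrank_eq_one {F M N : Type u} [Field F] [AddCommGroup M] [Module F M]
    [AddCommGroup N] [Module F N] (e : M ⊗[F] N ≃ₗ[F] F) : Module.finrank F M = 1 := by
  have h := e.finrank_eq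
  rw [Module.finrank_tensorProduct, Module.finrank_self] at h
  exact Nat.eq_one_of_mul_eq_one_right h

/-- An invertible object is isomorphic to some `(K, k, φ)`. -/
theorem exists_iso_line_of_tensor_iso {X Y : DInf k K P} (e : X ⊗ Y ≅ 𝟙_ (DInf k K P)) :
    ∃ φ : Pˣ, Nonempty (X ≅ line k K φ) := by
  have hV : Module.finrank K X.V = 1 := finrank_eq_one (N := Y.V) (isoV e)
  have hW : Module.finrank k X.W = 1 := finrank_eq_one (N := Y.W) (isoW e)
  exact exists_iso_line X
    (LinearEquiv.ofFinrankEq X.V K (by rw [hV, Module.finrank_self]))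
    (LinearEquiv.ofFinrankEq X.W k (by rw [hW, Module.finrank_self]))

/-- The homomorphism `P^* → Pic(D_∞(K/k))` that sends `φ` to the class of `(K, k, φ)`. -/
def linePic (k K P : Type u) [Field k] [Field K] [Field P] [Algebra K P] [Algebra k P] :
    Pˣ →* Pic k K P :=
  MonoidHom.toHomUnits
    { toFun := fun φ => toSkeleton (line k K φ)
      map_one' := rfl
      map_mul' := fun φ φ' => by
        rw [← Skeleton.toSkeleton_tensorObj, toSkeleton_eq_toSkeleton_iff]
        exact ⟨(lineTensorIso φ φ').symm⟩ }

/-- An inverse class gives `X ⊗ Y ≅ 𝟙` for representatives. Dimensions multiply, so `V` and `W` both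
have dimension one. -/
theorem linePic_surjective : Function.Surjective (linePic k K P) := by
  intro L
  have h : (L : Skeleton (DInf k K P)) * (L⁻¹ : Pic k K P) = 1 := L.mul_inv
  rw [Skeleton.mul_eq, Skeleton.one_eq, toSkeleton_eq_toSkeleton_iff] at h
  obtain ⟨e⟩ := h
  obtain ⟨φ, ⟨i⟩⟩ := exists_iso_line_of_tensor_iso e
  exact ⟨φ, Units.ext ((congr_toSkeleton_of_iso i.symm).trans (Quotient.out_eq _))⟩

end DInf

/-! ### The two kernels and the main theorem -/

open DInf localNori

/-- The homomorphism `P^* → Hom(π^L(K/k), 𝔾_m)` that sends `φ` to the character of `(K, k, φ)`. -/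
def lineCharacters (k K P : Type u) [Field k] [Field K] [Field P] [Algebra K P] [Algebra k P] :
    Pˣ →* characters k K P :=
  MonoidHom.mk' lineCharacter lineCharacter_mul

variable {k K P : Type u} [Field k] [Field K] [Field P] [Algebra K P] [Algebra k P]

theorem lineCharacter_eq_one_of_linePic {φ : Pˣ} (h : linePic k K P φ = 1) :
    (lineCharacter φ : characters k K P) = 1 := by
  have h1 : toSkeleton (line k K φ) = toSkeleton (line k K (1 : Pˣ)) :=
    congrArg Units.val h
  obtain ⟨e⟩ := toSkeleton_eq_toSkeleton_iff.mp h1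
  rw [lineCharacter_eq_of_iso e]
  exact (lineCharacters k K P).map_one

/-- Multiplication by `c` on `V = K` and the identity on `W = k` give an isomorphism from `(K, k,
c)` to the unit. -/
theorem linePic_algebraMap (c : Kˣ) :
    linePic k K P (Units.map (algebraMap K P : K →* P) c) = 1 := by
  refine Units.ext (congr_toSkeleton_of_iso (Y := line k K 1)
    (mkIso (LinearEquiv.smulOfUnit c : K ≃ₗ[K] K) (.refl k k) ?_))
  ext
  change (line k K (1 : Pˣ)).ψ (1 ⊗ₜ[K] (c • (1 : K))) = LinearMap.baseChange P
    (LinearEquiv.refl k k).toLinearMap ((line k K _).ψ (1 ⊗ₜ[K] (1 : K)))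
  rw [line_ψ_tmul, line_ψ_tmul]
  simp [Units.smul_def, Algebra.smul_def]

variable [Algebra k K] [IsScalarTower k K P]

/-- The canonical point detects membership in `K^*`; conversely, for `φ ∈ K^*` the line is
isomorphic to the unit object. -/
theorem ker_lineCharacters :
    (lineCharacters k K P).ker = (Units.map (algebraMap K P : K →* P)).range := by
  ext φ
  rw [MonoidHom.mem_ker, MonoidHom.mem_range]
  constructor
  · intro h
    obtain ⟨c, hc⟩ := mem_of_lineCharacter_eq_one h
    have hc0 : c ≠ 0 := by
      rintro rfl
      exact φ.ne_zero (hc.symm.trans (map_zero _))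
    exact ⟨Units.mk0 c hc0, Units.ext hc⟩
  · rintro ⟨c, rfl⟩
    exact lineCharacter_eq_one_of_linePic (linePic_algebraMap c)

/-- A line isomorphic to the unit has trivial character, so the upper bound is inherited from the
kernel on characters. -/
theorem ker_linePic :
    (linePic k K P).ker = (Units.map (algebraMap K P : K →* P)).range := by
  apply le_antisymm
  · rw [← ker_lineCharacters (k := k)]
    exact fun φ h => lineCharacter_eq_one_of_linePic h
  · rintro _ ⟨c, rfl⟩
    exact linePic_algebraMap c

/-- The isomorphism `P^* / K^* ≃ Pic(D_∞(K/k))`. -/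
def quotientEquivPic (k K P : Type u) [Field k] [Field K] [Field P] [Algebra K P] [Algebra k P]
    [Algebra k K] [IsScalarTower k K P] :
    Pˣ ⧸ (Units.map (algebraMap K P : K →* P)).range ≃* Pic k K P :=
  (QuotientGroup.quotientMulEquivOfEq ker_linePic.symm).trans
    (QuotientGroup.quotientKerEquivOfSurjective _ linePic_surjective)

/-- The isomorphism `P^* / K^* ≃ Hom(π^L(K/k), 𝔾_m)`. -/
def quotientEquivCharacters (k K P : Type u) [Field k] [Field K] [Field P] [Algebra K P]
    [Algebra k P] [Algebra k K] [IsScalarTower k K P] :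
    Pˣ ⧸ (Units.map (algebraMap K P : K →* P)).range ≃* characters k K P :=
  (QuotientGroup.quotientMulEquivOfEq ker_lineCharacters.symm).trans
    (QuotientGroup.quotientKerEquivOfSurjective (lineCharacters k K P) lineCharacter_surjective)

end

theorem mainTheorem2 (p : ℕ) [Fact p.Prime] {k K P : Type u} [Field k] [CharP k p] [PerfectField k]
    [Field K] [Algebra k K]
    [Field P] [Algebra K P] [Algebra k P] [IsScalarTower k K P]
    [CharP P p] [PerfectRing P p] [IsPerfectClosure (algebraMap K P) p] :
    localNori.IsAffineGroupScheme k K P ∧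
    ∃ (α : DInf.Pic k K P ≃* localNori.characters k K P)
      (β : localNori.characters k K P ≃* Pˣ ⧸ (Units.map (algebraMap K P : K →* P)).range),
      (∀ (L : DInf.Pic k K P) (X : DInf k K P), toSkeleton X = (L : Skeleton (DInf k K P)) →
        ∀ (R : CommAlgCat.{u} k) (g : localNori k K P R) (x : R ⊗[k] X.W),
          g.1 X x = ((α L).1 R g : R) • x) ∧
      ∀ φ : Pˣ, ((α.symm (β.symm (QuotientGroup.mk φ)) : DInf.Pic k K P) :
        Skeleton (DInf k K P)) = toSkeleton (DInf.line k K φ) := by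
  refine ⟨localNori.isAffineGroupScheme,
    (quotientEquivPic k K P).symm.trans (quotientEquivCharacters k K P),
    (quotientEquivCharacters k K P).symm, fun L X hX R g x => ?_, fun φ => ?_⟩
  -- Every representative `X` of the class is isomorphic to some `(K, k, φ)`, and both isomorphisms
  -- out of `P^*/K^*` are defined on the class of `φ` by this line.
  · obtain ⟨φ, rfl⟩ := DInf.linePic_surjective L
    obtain ⟨e⟩ := toSkeleton_eq_toSkeleton_iff.mp hX
    have h : (quotientEquivPic k K P).symm (DInf.linePic k K P φ) = QuotientGroup.mk φ :=
      (MulEquiv.symm_apply_eq _).mpr rfl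
    rw [MulEquiv.trans_apply, h]
    exact localNori.apply_of_iso_line e R g x
  · simp only [MulEquiv.symm_trans_apply, MulEquiv.symm_symm, MulEquiv.symm_apply_apply]
    rfl
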